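/- Let $G$ be a finite group. A Mackey functor $\mathcal M$ assigns to each finite left $G$-set $S$ an abelian group $\mathcal M(S)$, and to each $G$-map $\varphi\colon S\to T$ functorially a covariant homomorphism $\varphi_{\mathcal M}\colon\mathcal M(S)\to\mathcal M(T)$ and a contravariant one $\varphi^{\mathcal M}\colon\mathcal M(T)\to\mathcal M(S)$, such that (M1) for every pullback square of finite $G$-sets with sides $\Psi\colon S\to S_1$, $\Phi\colon S\to S_2$, $\varphi\colon S_1\to T$, $\psi\colon S_2\to T$ one has $\varphi^{\mathcal M}\psi_{\mathcal M}=\Psi_{\mathcal M}\Phi^{\mathcal M}$, and (M2) the restrictions along the two embeddings give an isomorphism $\mathcal M(S_1\sqcup S_2)\to\mathcal M(S_1)\oplus\mathcal M(S_2)$, and $\mathcal M(\emptyset)=0$. A Green ring $\mathcal G$ is a Mackey functor with bilinear maps $\mathcal G(S)\times\mathcal G(S)\to\mathcal G(S)$ making each $\mathcal G(S)$ an associative ring with unit $1_S$, such that for every $\varphi\colon S\to T$: $\varphi^{\mathcal G}(xy)=\varphi^{\mathcal G}(x)\varphi^{\mathcal G}(y)$, $\varphi^{\mathcal G}(1_T)=1_S$,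 $x\cdot\varphi_{\mathcal G}(y)=\varphi_{\mathcal G}(\varphi^{\mathcal G}(x)\cdot y)$ and $\varphi_{\mathcal G}(x)\cdot y=\varphi_{\mathcal G}(x\cdot\varphi^{\mathcal G}(y))$. The Burnside ring $\mathcal A$ is the Green ring whose value $\mathcal A(S)$ is the Grothendieck group of isomorphism classes of finite $G$-sets $(X,f\colon X\to S)$ over $S$ under disjoint union, with covariant maps given by composition, and contravariant maps and product given by pullback. It acts on every Mackey functor $\mathcal M$ by $[X,f]\cdot x=f_{\mathcal M}(f^{\mathcal M}(x))$. Let $I_{\mathcal M}(S)$ be the set of $a\in\mathcal A(S)$ such that $\varphi_{\mathcal A}(a)\cdot y=0$ and $\psi^{\mathcal A}(a)\cdot z=0$ for all $G$-maps $\varphi\colon S\to T$, $\psi\colon U\to S$ of finite $G$-sets and all $y\in\mathcal M(T)$, $z\in\mathcal M(U)$. The Burnside quotient Green ring of $\mathcal M$ is the quotient Green ring $\mathcal A_{\mathcal M}=\mathcal A/I_{\mathcal M}$, with values $\mathcal A(S)/I_{\mathcal M}(S)$. For a prime $p$ and a finite group $H$, let $O^p(H)$ be the intersection of all normal subgroups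 of $H$ whose quotient is a $p$-group. For a finite $G$-set $X$, let $\mathcal F(X)$ be the family of all subgroups of $G$ contained in the stabilizer of some point of $X$, let $hyper_p\text{-}\mathcal F(X)$ be the family of all subgroups $H\le G$ with $O^p(H)\in\mathcal F(X)$, and let $hyper_p\text{-}X$ be the disjoint union of the $G$-sets $G/H$, one for each conjugacy class of maximal elements $H$ of $hyper_p\text{-}\mathcal F(X)$. Then $X$ is called a Dress generating set for a Green ring $\mathcal G$ if for every prime $p$ the homomorphism $\mathcal G(hyper_p\text{-}X)\otimes\mathbf Z_{(p)}\to\mathcal G(\bullet)\otimes\mathbf Z_{(p)}$ given by the covariant map of the projection $hyper_p\text{-}X\to\bullet$ to the one-point $G$-set is surjective. Theorem. Let $\mathcal G$ be a Green ring and $X$ a finite $G$-set. Then $X$ is a Dress generating set for $\mathcal G$ if and only if $X$ is a Dress generating set for the Burnside quotient Green ring $\mathcal A_{\mathcal G}$ of (the underlying Mackey functor of) $\mathcal G$. -/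

import Mathlib

universe u v w w' w''

namespace DressInduction

/-! ### Finite `G`-sets -/

/-- A finite left `G`-set. A `G`-map from `S` to `T` is a term of `S →[G] T`. -/
structure FinGSet (G : Type u) [Group G] : Type (u + 1) where
  carrier : Type u
  [action : MulAction G carrier]
  [finite : Finite carrier]

namespace FinGSet

variable {G : Type u} [Group G]

instance : CoeSort (FinGSet G) (Type u) := ⟨FinGSet.carrier⟩

attribute [instance] FinGSet.action FinGSet.finite

/-- The empty `G`-set. -/
def empty (G : Type u) [Group G] : FinGSet G where
  carrier := PEmpty.{u + 1}
  action := { smul := fun _ x => x, one_smul := fun _ => rfl, mul_smul := fun _ _ _ => rfl }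

instance : IsEmpty (empty G) := inferInstanceAs (IsEmpty PEmpty)

/-- The one-point `G`-set. -/
def point (G : Type u) [Group G] : FinGSet G where
  carrier := PUnit.{u + 1}
  action := { smul := fun _ x => x, one_smul := fun _ => rfl, mul_smul := fun _ _ _ => rfl }

/-- The disjoint union of two finite `G`-sets. -/
def sum (S T : FinGSet G) : FinGSet G where
  carrier := S ⊕ T

/-- The projection of a finite `G`-set to the one-point `G`-set. -/
def toPoint (S : FinGSet G) : S →[G] point G where
  toFun _ := PUnit.unit
  map_smul' _ _ := rfl

/-- The embedding of the first summand of a disjoint union. -/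
def inl (S T : FinGSet G) : S →[G] sum S T where
  toFun := Sum.inl
  map_smul' _ _ := rfl

/-- The embedding of the second summand of a disjoint union. -/
def inr (S T : FinGSet G) : T →[G] sum S T where
  toFun := Sum.inr
  map_smul' _ _ := rfl

/-- The `G`-map out of a disjoint union given by two `G`-maps. -/
def desc {S T U : FinGSet G} (f : S →[G] U) (g : T →[G] U) : sum S T →[G] U where
  toFun := Sum.elim f g
  map_smul' a x := by
    rcases x with x | x
    · exact map_smul f a x
    · exact map_smul g a x

/-- The pullback of `f : S → U` and `g : T → U`, i.e. all pairs `(s, t)` with `f s = g t`. -/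
def pullback {S T U : FinGSet G} (f : S →[G] U) (g : T →[G] U) : FinGSet G where
  carrier := {q : S × T // f q.1 = g q.2}
  action :=
    { smul := fun a q => ⟨(a • q.1.1, a • q.1.2), by
        rw [map_smul, map_smul, q.2]⟩
      one_smul := fun q => Subtype.ext (one_smul G q.1)
      mul_smul := fun a b q => Subtype.ext (mul_smul a b q.1) }

/-- The first projection of a pullback. -/
def pullbackFst {S T U : FinGSet G} (f : S →[G] U) (g : T →[G] U) : pullback f g →[G] S where
  toFun q := q.1.1
  map_smul' _ _ := rfl

/-- The second projection of a pullback. -/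
def pullbackSnd {S T U : FinGSet G} (f : S →[G] U) (g : T →[G] U) : pullback f g →[G] T where
  toFun q := q.1.2
  map_smul' _ _ := rfl

/-- The square with sides `Ψ : S → S₁`, `Φ : S → S₂`, `φ : S₁ → T`, `ψ : S₂ → T` is a pullback
diagram of `G`-sets: it commutes, and each `(s₁, s₂)` with `φ s₁ = ψ s₂` comes from exactly one
point of `S`. -/
def IsPullbackSquare {S S₁ S₂ T : FinGSet G} (Ψ : S →[G] S₁) (Φ : S →[G] S₂)
    (φ : S₁ →[G] T) (ψ : S₂ →[G] T) : Prop :=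
  (∀ s, φ (Ψ s) = ψ (Φ s)) ∧
    ∀ s₁ s₂, φ s₁ = ψ s₂ → ∃! s, Ψ s = s₁ ∧ Φ s = s₂

theorem isPullbackSquare_pullback {S T U : FinGSet G} (f : S →[G] U) (g : T →[G] U) :
    IsPullbackSquare (pullbackFst f g) (pullbackSnd f g) f g :=
  ⟨fun q => q.2, fun s t h => ⟨⟨(s, t), h⟩, ⟨rfl, rfl⟩,
    fun _ hq => Subtype.ext (Prod.ext hq.1 hq.2)⟩⟩

end FinGSet

open FinGSet

/-! ### Mackey functors -/

/-- A Mackey functor: a bifunctor from finite `G`-sets to abelian groups with covariant maps `ind`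
and contravariant maps `res` that agree on objects, which satisfies the double coset formula and
is additive. -/
structure MackeyFunctor (G : Type u) [Group G] : Type (max (u + 1) (w + 1)) where
  obj : FinGSet G → Type w
  [grp : ∀ S, AddCommGroup (obj S)]
  ind : ∀ {S T : FinGSet G}, (S →[G] T) → (obj S →+ obj T)
  res : ∀ {S T : FinGSet G}, (S →[G] T) → (obj T →+ obj S)
  ind_id : ∀ (S : FinGSet G) (x : obj S), ind (MulActionHom.id G : S →[G] S) x = x
  ind_comp : ∀ {S T U : FinGSet G} (g : T →[G] U) (f : S →[G] T) (x : obj S),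
    ind (g.comp f) x = ind g (ind f x)
  res_id : ∀ (S : FinGSet G) (x : obj S), res (MulActionHom.id G : S →[G] S) x = x
  res_comp : ∀ {S T U : FinGSet G} (g : T →[G] U) (f : S →[G] T) (x : obj U),
    res (g.comp f) x = res f (res g x)
  res_ind : ∀ {S S₁ S₂ T : FinGSet G} (Ψ : S →[G] S₁) (Φ : S →[G] S₂)
    (φ : S₁ →[G] T) (ψ : S₂ →[G] T), IsPullbackSquare Ψ Φ φ ψ →
    ∀ x : obj S₂, res φ (ind ψ x) = ind Ψ (res Φ x)
  additive : ∀ S T : FinGSet G, Function.Bijective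
    (fun x : obj (sum S T) => (res (inl S T) x, res (inr S T) x))
  obj_empty : Subsingleton (obj (FinGSet.empty G))

attribute [instance] MackeyFunctor.grp

namespace MackeyFunctor

variable {G : Type u} [Group G] (M : MackeyFunctor.{u, w} G)

theorem ind_res_of_bijective {S T : FinGSet G} (e : S →[G] T) (he : Function.Bijective e)
    (x : M.obj T) : M.ind e (M.res e x) = x := by
  have h : IsPullbackSquare e e (MulActionHom.id G : T →[G] T) (MulActionHom.id G) := by
    refine ⟨fun _ => rfl, fun s₁ s₂ hs => ?_⟩
    obtain ⟨s, hs'⟩ := he.2 s₁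
    refine ⟨s, ⟨hs', hs'.trans hs⟩, fun t ht => he.1 (ht.1.trans hs'.symm)⟩
  have := M.res_ind e e _ _ h x
  rw [M.ind_id, M.res_id] at this
  exact this.symm

theorem res_ind_of_injective {S T : FinGSet G} (i : S →[G] T) (hi : Function.Injective i)
    (x : M.obj S) : M.res i (M.ind i x) = x := by
  have h : IsPullbackSquare (MulActionHom.id G : S →[G] S) (MulActionHom.id G) i i :=
    ⟨fun _ => rfl, fun s₁ s₂ hs => ⟨s₁, ⟨rfl, hi hs⟩, fun t ht => ht.1⟩⟩
  rw [M.res_ind _ _ _ _ h, M.res_id, M.ind_id]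

/-- The map out of the empty `G`-set. -/
def fromEmpty (S : FinGSet G) : FinGSet.empty G →[G] S where
  toFun x := isEmptyElim x
  map_smul' _ x := isEmptyElim x

theorem res_ind_of_disjoint {S T U : FinGSet G} (i : S →[G] U) (j : T →[G] U)
    (hij : ∀ s t, i s ≠ j t) (x : M.obj T) : M.res i (M.ind j x) = 0 := by
  have h : IsPullbackSquare (fromEmpty S) (fromEmpty T) i j :=
    ⟨fun x => isEmptyElim x, fun s₁ s₂ hs => (hij _ _ hs).elim⟩
  have := M.obj_empty
  rw [M.res_ind _ _ _ _ h, Subsingleton.elim (M.res (fromEmpty T) x) 0, map_zero]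

theorem eq_ind_add_ind {S T : FinGSet G} (x : M.obj (sum S T)) :
    x = M.ind (inl S T) (M.res (inl S T) x) + M.ind (inr S T) (M.res (inr S T) x) := by
  apply (M.additive S T).1
  have hl : Function.Injective (inl S T) := Sum.inl_injective
  have hr : Function.Injective (inr S T) := Sum.inr_injective
  have hlr : ∀ s t, inl S T s ≠ inr S T t := fun _ _ => Sum.inl_ne_inr
  have hrl : ∀ s t, inr S T s ≠ inl S T t := fun _ _ => Sum.inr_ne_inl
  simp only [map_add, M.res_ind_of_injective _ hl, M.res_ind_of_injective _ hr,
    M.res_ind_of_disjoint _ _ hlr, M.res_ind_of_disjoint _ _ hrl, add_zero, zero_add]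

end MackeyFunctor

/-! ### Pairings, Green rings, Green modules -/

/-- A pairing `M × N → L` of Mackey functors. -/
structure Pairing {G : Type u} [Group G] (M : MackeyFunctor.{u, w} G)
    (N : MackeyFunctor.{u, w'} G) (L : MackeyFunctor.{u, w''} G) where
  pair : ∀ S : FinGSet G, M.obj S →+ N.obj S →+ L.obj S
  res_pair : ∀ {S T : FinGSet G} (φ : S →[G] T) (x : M.obj T) (y : N.obj T),
    L.res φ (pair T x y) = pair S (M.res φ x) (N.res φ y)
  pair_ind : ∀ {S T : FinGSet G} (φ : S →[G] T) (x : M.obj T) (y : N.obj S),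
    pair T x (N.ind φ y) = L.ind φ (pair S (M.res φ x) y)
  ind_pair : ∀ {S T : FinGSet G} (φ : S →[G] T) (x : M.obj S) (y : N.obj T),
    pair T (M.ind φ x) y = L.ind φ (pair S x (N.res φ y))

/-- A Green ring: a Mackey functor with a pairing with itself that makes each value an
associative unital ring, such that restrictions preserve the units. -/
structure GreenRing (G : Type u) [Group G] where
  toMackey : MackeyFunctor.{u, w} G
  mul : Pairing toMackey toMackey toMackey
  one : ∀ S : FinGSet G, toMackey.obj S
  mul_assoc : ∀ (S : FinGSet G) (x y z : toMackey.obj S),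
    mul.pair S (mul.pair S x y) z = mul.pair S x (mul.pair S y z)
  one_mul : ∀ (S : FinGSet G) (x : toMackey.obj S), mul.pair S (one S) x = x
  mul_one : ∀ (S : FinGSet G) (x : toMackey.obj S), mul.pair S x (one S) = x
  res_one : ∀ {S T : FinGSet G} (φ : S →[G] T), toMackey.res φ (one T) = one S

/-- The structure of a (left) Green module over the Green ring `R` on a Mackey functor `M`. -/
structure GreenModule {G : Type u} [Group G] (R : GreenRing.{u, w} G)
    (M : MackeyFunctor.{u, w'} G) extends Pairing R.toMackey M M where
  mul_pair : ∀ (S : FinGSet G) (a b : R.toMackey.obj S) (x : M.obj S),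
    pair S (R.mul.pair S a b) x = pair S a (pair S b x)
  one_pair : ∀ (S : FinGSet G) (x : M.obj S), pair S (R.one S) x = x

/-! ### Two-sided Green ideals and quotient Green rings -/

/-- A two-sided Green ideal: a sub-bifunctor whose values are two-sided ideals. -/
structure GreenIdeal {G : Type u} [Group G] (R : GreenRing.{u, w} G) where
  ideal : ∀ S : FinGSet G, AddSubgroup (R.toMackey.obj S)
  ind_mem : ∀ {S T : FinGSet G} (φ : S →[G] T) {a : R.toMackey.obj S},
    a ∈ ideal S → R.toMackey.ind φ a ∈ ideal T
  res_mem : ∀ {S T : FinGSet G} (φ : S →[G] T) {a : R.toMackey.obj T},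
    a ∈ ideal T → R.toMackey.res φ a ∈ ideal S
  mul_mem_left : ∀ (S : FinGSet G) (b : R.toMackey.obj S) {a : R.toMackey.obj S},
    a ∈ ideal S → R.mul.pair S b a ∈ ideal S
  mul_mem_right : ∀ (S : FinGSet G) {a : R.toMackey.obj S} (b : R.toMackey.obj S),
    a ∈ ideal S → R.mul.pair S a b ∈ ideal S

namespace GreenRing

variable {G : Type u} [Group G] (R : GreenRing.{u, w} G) (I : GreenIdeal R)

/-- The quotient of a Green ring by a two-sided Green ideal, as a Mackey functor. -/
def quotientMackey : MackeyFunctor.{u, w} G where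
  obj S := R.toMackey.obj S ⧸ I.ideal S
  ind φ := QuotientAddGroup.map _ _ (R.toMackey.ind φ) fun _ h => I.ind_mem φ h
  res φ := QuotientAddGroup.map _ _ (R.toMackey.res φ) fun _ h => I.res_mem φ h
  ind_id S x := by
    induction x using QuotientAddGroup.induction_on with
    | H x => exact congrArg _ (R.toMackey.ind_id S x)
  ind_comp g f x := by
    induction x using QuotientAddGroup.induction_on with
    | H x => exact congrArg _ (R.toMackey.ind_comp g f x)
  res_id S x := by
    induction x using QuotientAddGroup.induction_on with
    | H x => exact congrArg _ (R.toMackey.res_id S x)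
  res_comp g f x := by
    induction x using QuotientAddGroup.induction_on with
    | H x => exact congrArg _ (R.toMackey.res_comp g f x)
  res_ind Ψ Φ φ ψ h x := by
    induction x using QuotientAddGroup.induction_on with
    | H x => exact congrArg _ (R.toMackey.res_ind Ψ Φ φ ψ h x)
  additive S T := by
    constructor
    · suffices ∀ x : R.toMackey.obj (sum S T) ⧸ I.ideal (sum S T),
          QuotientAddGroup.map _ _ (R.toMackey.res (inl S T))
            (fun _ h => I.res_mem (inl S T) h) x = 0 →
          QuotientAddGroup.map _ _ (R.toMackey.res (inr S T))
            (fun _ h => I.res_mem (inr S T) h) x = 0 → x = 0 by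
        intro x y hxy
        have h1 := congrArg Prod.fst hxy
        have h2 := congrArg Prod.snd hxy
        refine sub_eq_zero.1 (this (x - y) ?_ ?_)
        · rw [map_sub]; exact sub_eq_zero.2 h1
        · rw [map_sub]; exact sub_eq_zero.2 h2
      intro x
      induction x using QuotientAddGroup.induction_on with
      | H x =>
        intro h1 h2
        have h1' := (QuotientAddGroup.eq_zero_iff _).1 h1
        have h2' := (QuotientAddGroup.eq_zero_iff _).1 h2
        refine (QuotientAddGroup.eq_zero_iff _).2 ?_
        rw [R.toMackey.eq_ind_add_ind x]
        exact add_mem (I.ind_mem _ h1') (I.ind_mem _ h2')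
    · rintro ⟨x, y⟩
      induction x using QuotientAddGroup.induction_on with
      | H x =>
      induction y using QuotientAddGroup.induction_on with
      | H y =>
      obtain ⟨z, hz⟩ := (R.toMackey.additive S T).2 (x, y)
      refine ⟨(z : R.toMackey.obj (sum S T) ⧸ I.ideal (sum S T)), Prod.ext ?_ ?_⟩
      · exact congrArg (QuotientAddGroup.mk' (I.ideal S)) (congrArg Prod.fst hz)
      · exact congrArg (QuotientAddGroup.mk' (I.ideal T)) (congrArg Prod.snd hz)
  obj_empty := by
    have := R.toMackey.obj_empty
    exact Quotient.instSubsingletonQuotient _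

/-- Left multiplication by `a` on the quotient by a two-sided Green ideal. -/
def quotientMulLeft (S : FinGSet G) (a : R.toMackey.obj S) :
    (R.quotientMackey I).obj S →+ (R.quotientMackey I).obj S :=
  QuotientAddGroup.map (I.ideal S) (I.ideal S) (R.mul.pair S a) fun _ h => I.mul_mem_left S a h

/-- The multiplication induced on the quotient by a two-sided Green ideal. -/
def quotientMul (S : FinGSet G) :
    (R.quotientMackey I).obj S →+ (R.quotientMackey I).obj S →+ (R.quotientMackey I).obj S :=
  QuotientAddGroup.lift (I.ideal S)
    { toFun := R.quotientMulLeft I S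
      map_zero' := by
        refine AddMonoidHom.ext fun x => ?_
        induction x using QuotientAddGroup.induction_on with
        | H x =>
          exact congrArg (QuotientAddGroup.mk' (I.ideal S))
            (DFunLike.congr_fun (map_zero (R.mul.pair S)) x)
      map_add' := fun a b => by
        refine AddMonoidHom.ext fun x => ?_
        induction x using QuotientAddGroup.induction_on with
        | H x =>
          exact congrArg (QuotientAddGroup.mk' (I.ideal S))
            (DFunLike.congr_fun (map_add (R.mul.pair S) a b) x) }
    (fun a ha => by
      refine AddMonoidHom.ext fun x => ?_
      induction x using QuotientAddGroup.induction_on with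
      | H x => exact (QuotientAddGroup.eq_zero_iff _).2 (I.mul_mem_right S x ha))

/-- The quotient Green ring `R / I`, whose value at `S` is `R(S) / I(S)`. -/
def quotient : GreenRing.{u, w} G where
  toMackey := R.quotientMackey I
  mul :=
    { pair := R.quotientMul I
      res_pair := fun {S T} φ x y => by
        induction x using QuotientAddGroup.induction_on with
        | H x =>
        induction y using QuotientAddGroup.induction_on with
        | H y => exact congrArg (QuotientAddGroup.mk' (I.ideal S)) (R.mul.res_pair φ x y)
      pair_ind := fun {S T} φ x y => by
        induction x using QuotientAddGroup.induction_on with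
        | H x =>
        induction y using QuotientAddGroup.induction_on with
        | H y => exact congrArg (QuotientAddGroup.mk' (I.ideal T)) (R.mul.pair_ind φ x y)
      ind_pair := fun {S T} φ x y => by
        induction x using QuotientAddGroup.induction_on with
        | H x =>
        induction y using QuotientAddGroup.induction_on with
        | H y => exact congrArg (QuotientAddGroup.mk' (I.ideal T)) (R.mul.ind_pair φ x y) }
  one S := QuotientAddGroup.mk' (I.ideal S) (R.one S)
  mul_assoc S x y z := by
    induction x using QuotientAddGroup.induction_on with
    | H x =>
    induction y using QuotientAddGroup.induction_on with
    | H y =>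
    induction z using QuotientAddGroup.induction_on with
    | H z => exact congrArg (QuotientAddGroup.mk' (I.ideal S)) (R.mul_assoc S x y z)
  one_mul S x := by
    induction x using QuotientAddGroup.induction_on with
    | H x => exact congrArg (QuotientAddGroup.mk' (I.ideal S)) (R.one_mul S x)
  mul_one S x := by
    induction x using QuotientAddGroup.induction_on with
    | H x => exact congrArg (QuotientAddGroup.mk' (I.ideal S)) (R.mul_one S x)
  res_one {S T} φ := congrArg (QuotientAddGroup.mk' (I.ideal S)) (R.res_one φ)

end GreenRing

/-- The Green ideal `I_M` of a Green module `M` over `R`: the elements `a` of `R(S)` such that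
`φ_* a` kills `M(T)` for all `φ : S → T`, and `ψ^* a` kills `M(U)` for all `ψ : U → S`. -/
def GreenModule.annihilator {G : Type u} [Group G] {R : GreenRing.{u, w} G}
    {M : MackeyFunctor.{u, w'} G} (P : GreenModule R M) : GreenIdeal R where
  ideal S :=
    { carrier := {a | (∀ (T : FinGSet G) (φ : S →[G] T) (y : M.obj T),
          P.pair T (R.toMackey.ind φ a) y = 0) ∧
        (∀ (U : FinGSet G) (ψ : U →[G] S) (z : M.obj U),
          P.pair U (R.toMackey.res ψ a) z = 0)}
      zero_mem' := by simp
      add_mem' := fun {a b} ha hb => ⟨fun T φ y => by simp [ha.1, hb.1],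
        fun U ψ z => by simp [ha.2, hb.2]⟩
      neg_mem' := fun {a} ha => ⟨fun T φ y => by simp [ha.1], fun U ψ z => by simp [ha.2]⟩ }
  ind_mem {S W} l {a} ha := by
    refine ⟨fun T φ y => ?_, fun U ψ z => ?_⟩
    · rw [← R.toMackey.ind_comp]
      exact ha.1 T _ y
    · rw [R.toMackey.res_ind _ _ _ _ (isPullbackSquare_pullback ψ l), P.ind_pair, ha.2, map_zero]
  res_mem {V S} m {a} ha := by
    refine ⟨fun T φ y => ?_, fun U ψ z => ?_⟩
    · rw [P.ind_pair, ha.2, map_zero]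
    · rw [← R.toMackey.res_comp]
      exact ha.2 U _ z
  mul_mem_left S b {a} ha := by
    have key : ∀ z, P.pair S a z = 0 := fun z => by
      have := ha.2 S (MulActionHom.id G) z
      rwa [R.toMackey.res_id] at this
    refine ⟨fun T φ y => ?_, fun U ψ z => ?_⟩
    · rw [P.ind_pair, P.mul_pair, key, map_zero, map_zero]
    · rw [R.mul.res_pair, P.mul_pair, ha.2, map_zero]
  mul_mem_right S {a} b ha := by
    have key : ∀ z, P.pair S a z = 0 := fun z => by
      have := ha.2 S (MulActionHom.id G) z
      rwa [R.toMackey.res_id] at this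
    refine ⟨fun T φ y => ?_, fun U ψ z => ?_⟩
    · rw [P.ind_pair, P.mul_pair, key, map_zero]
    · rw [R.mul.res_pair, P.mul_pair, ha.2]

/-! ### The Burnside ring -/

section Burnside

variable {G : Type u} [Group G]

/-- An object `(X, f)` of the category of finite `G`-sets over `S`. -/
structure GSetOver (S : FinGSet G) : Type (u + 1) where
  total : FinGSet G
  hom : total →[G] S

namespace GSetOver

/-- Isomorphism of finite `G`-sets over `S`. -/
instance setoid (S : FinGSet G) : Setoid (GSetOver S) where
  r X Y := ∃ e : X.total →[G] Y.total, Function.Bijective e ∧ Y.hom.comp e = X.hom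
  iseqv :=
    { refl := fun X => ⟨MulActionHom.id G, Function.bijective_id, MulActionHom.comp_id _⟩
      symm := by
        rintro X Y ⟨e, he, h⟩
        let e' := Equiv.ofBijective e he
        refine ⟨⟨e'.symm, fun g y => ?_⟩, e'.symm.bijective, ?_⟩
        · apply he.1
          have h1 := e'.apply_symm_apply (g • y)
          have h2 := e'.apply_symm_apply y
          exact h1.trans ((congrArg (g • ·) h2.symm).trans (map_smul e g _).symm)
        · ext y
          rw [← h]
          exact congrArg Y.hom (e'.apply_symm_apply y)
      trans := by
        rintro X Y Z ⟨e, he, h⟩ ⟨e', he', h'⟩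
        refine ⟨e'.comp e, he'.comp he, ?_⟩
        rw [← h, ← h']
        rfl }

/-- Disjoint union over `S`. -/
abbrev sum {S : FinGSet G} (X Y : GSetOver S) : GSetOver S :=
  ⟨FinGSet.sum X.total Y.total, desc X.hom Y.hom⟩

/-- Composition with `φ : S → T`. -/
abbrev push {S T : FinGSet G} (φ : S →[G] T) (X : GSetOver S) : GSetOver T :=
  ⟨X.total, φ.comp X.hom⟩

/-- Pullback along `φ : S → T`. -/
abbrev pull {S T : FinGSet G} (φ : S →[G] T) (Y : GSetOver T) : GSetOver S :=
  ⟨pullback φ Y.hom, pullbackFst φ Y.hom⟩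

/-- The empty `G`-set over `S`. -/
abbrev zero (S : FinGSet G) : GSetOver S := ⟨FinGSet.empty G, MackeyFunctor.fromEmpty S⟩

/-- The identity of `S`, as a `G`-set over `S`. -/
abbrev id (S : FinGSet G) : GSetOver S := ⟨S, MulActionHom.id G⟩

end GSetOver

/-- The set of isomorphism classes of finite `G`-sets over `S`. -/
def IsoClass (S : FinGSet G) : Type (u + 1) := Quotient (GSetOver.setoid S)

namespace IsoClass

/-- The isomorphism class of a finite `G`-set over `S`. -/
def mk {S : FinGSet G} (X : GSetOver S) : IsoClass S := Quotient.mk _ X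

theorem mk_eq {S : FinGSet G} {X Y : GSetOver S} (e : X.total → Y.total)
    (he : Function.Bijective e) (hsmul : ∀ (g : G) x, e (g • x) = g • e x)
    (hh : ∀ x, Y.hom (e x) = X.hom x) : mk X = mk Y :=
  Quotient.sound ⟨⟨e, hsmul⟩, he, MulActionHom.ext hh⟩

/-- The sum of isomorphism classes is the disjoint union. -/
instance (S : FinGSet G) : Add (IsoClass S) where
  add := Quotient.map₂ GSetOver.sum (by
    rintro X X' ⟨e, he, h⟩ Y Y' ⟨f, hf, h'⟩
    refine ⟨⟨Sum.map e f, ?_⟩, Function.Bijective.sumMap he hf, ?_⟩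
    · rintro g (x | x)
      · exact congrArg Sum.inl (map_smul e g x)
      · exact congrArg Sum.inr (map_smul f g x)
    · ext (x | x)
      · exact DFunLike.congr_fun h x
      · exact DFunLike.congr_fun h' x)

instance (S : FinGSet G) : Zero (IsoClass S) where
  zero := mk (GSetOver.zero S)

/-- Isomorphism classes form a commutative monoid under disjoint union. -/
instance (S : FinGSet G) : AddCommMonoid (IsoClass S) where
  add_assoc := by
    rintro ⟨X⟩ ⟨Y⟩ ⟨Z⟩
    refine mk_eq (Equiv.sumAssoc X.total Y.total Z.total) (Equiv.bijective _) ?_ ?_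
    · rintro g ((x | x) | x) <;> rfl
    · rintro ((x | x) | x) <;> rfl
  zero_add := by
    rintro ⟨X⟩
    refine mk_eq (Equiv.emptySum (FinGSet.empty G) X.total) (Equiv.bijective _) ?_ ?_
    · rintro g (x | x)
      · exact isEmptyElim x
      · rfl
    · rintro (x | x)
      · exact isEmptyElim x
      · rfl
  add_zero := by
    rintro ⟨X⟩
    refine mk_eq (Equiv.sumEmpty X.total (FinGSet.empty G)) (Equiv.bijective _) ?_ ?_
    · rintro g (x | x)
      · rfl
      · exact isEmptyElim x
    · rintro (x | x)
      · rfl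
      · exact isEmptyElim x
  add_comm := by
    rintro ⟨X⟩ ⟨Y⟩
    refine mk_eq (Equiv.sumComm X.total Y.total) (Equiv.bijective _) ?_ ?_
    · rintro g (x | x) <;> rfl
    · rintro (x | x) <;> rfl
  nsmul := nsmulRec

/-- Composition with `φ : S → T`, on isomorphism classes. -/
def push {S T : FinGSet G} (φ : S →[G] T) : IsoClass S →+ IsoClass T where
  toFun := Quotient.map (GSetOver.push φ) (by
    rintro X X' ⟨e, he, h⟩
    exact ⟨e, he, by ext x; exact congrArg φ (DFunLike.congr_fun h x)⟩)
  map_zero' := mk_eq _root_.id Function.bijective_id (fun _ _ => rfl) (fun x => isEmptyElim x)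
  map_add' := by
    rintro ⟨X⟩ ⟨Y⟩
    refine mk_eq _root_.id Function.bijective_id (fun _ _ => rfl) ?_
    rintro (x | x) <;> rfl

/-- Pullback along `φ : S → T`, on isomorphism classes. -/
def pull {S T : FinGSet G} (φ : S →[G] T) : IsoClass T →+ IsoClass S where
  toFun := Quotient.map (GSetOver.pull φ) (by
    rintro X X' ⟨e, he, h⟩
    refine ⟨⟨fun q => ⟨(q.1.1, e q.1.2), q.2.trans (DFunLike.congr_fun h q.1.2).symm⟩, ?_⟩,
      ⟨?_, ?_⟩, ?_⟩
    · intro g q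
      exact Subtype.ext (Prod.ext rfl (map_smul e g q.1.2))
    · intro q q' hq
      have hq' : (q.1.1, e q.1.2) = (q'.1.1, e q'.1.2) := congrArg Subtype.val hq
      exact Subtype.ext (Prod.ext (Prod.ext_iff.1 hq').1 (he.1 (Prod.ext_iff.1 hq').2))
    · rintro ⟨⟨s, x'⟩, hq⟩
      obtain ⟨x, rfl⟩ := he.2 x'
      exact ⟨⟨(s, x), hq.trans (DFunLike.congr_fun h x)⟩, rfl⟩
    · rfl)
  map_zero' := by
    refine mk_eq (fun q => q.1.2) ⟨fun q => isEmptyElim q.1.2, fun x => isEmptyElim x⟩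
      (fun _ q => isEmptyElim q.1.2) (fun q => isEmptyElim q.1.2)
  map_add' := by
    rintro ⟨X⟩ ⟨Y⟩
    symm
    refine mk_eq (X := (GSetOver.pull φ X).sum (GSetOver.pull φ Y))
      (Y := GSetOver.pull φ (X.sum Y))
      (Sum.elim (fun q => ⟨(q.1.1, Sum.inl q.1.2), q.2⟩) (fun q => ⟨(q.1.1, Sum.inr q.1.2), q.2⟩))
      ⟨?_, ?_⟩ ?_ ?_
    · rintro (⟨⟨s, x⟩, h⟩ | ⟨⟨s, x⟩, h⟩) (⟨⟨s', x'⟩, h'⟩ | ⟨⟨s', x'⟩, h'⟩) hq <;>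
        obtain ⟨hs, hx⟩ := Prod.ext_iff.1 (Subtype.ext_iff.1 hq) <;>
        obtain rfl : s = s' := hs
      · obtain rfl : x = x' := Sum.inl_injective hx
        rfl
      · exact absurd hx Sum.inl_ne_inr
      · exact absurd hx Sum.inr_ne_inl
      · obtain rfl : x = x' := Sum.inr_injective hx
        rfl
    · rintro ⟨⟨s, x | x⟩, h⟩
      · exact ⟨Sum.inl ⟨(s, x), h⟩, rfl⟩
      · exact ⟨Sum.inr ⟨(s, x), h⟩, rfl⟩
    · rintro g (q | q) <;> rfl
    · rintro (q | q) <;> rfl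

theorem push_id {S : FinGSet G} (a : IsoClass S) : push (MulActionHom.id G) a = a := by
  obtain ⟨X⟩ := a
  exact mk_eq _root_.id Function.bijective_id (fun _ _ => rfl) (fun _ => rfl)

theorem push_comp {S T U : FinGSet G} (g : T →[G] U) (f : S →[G] T) (a : IsoClass S) :
    push (g.comp f) a = push g (push f a) := by
  obtain ⟨X⟩ := a
  exact mk_eq _root_.id Function.bijective_id (fun _ _ => rfl) (fun _ => rfl)

theorem pull_id {S : FinGSet G} (a : IsoClass S) : pull (MulActionHom.id G) a = a := by
  obtain ⟨X⟩ := a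
  refine mk_eq (X := GSetOver.pull (MulActionHom.id G) X) (Y := X) (fun q => q.1.2)
    ⟨?_, ?_⟩ (fun _ _ => rfl) (fun q => q.2.symm)
  · rintro ⟨⟨s, x⟩, h⟩ ⟨⟨s', x'⟩, h'⟩ hx
    obtain rfl : x = x' := hx
    exact Subtype.ext (Prod.ext (h.trans h'.symm) rfl)
  · intro x
    exact ⟨⟨(X.hom x, x), rfl⟩, rfl⟩

theorem pull_comp {S T U : FinGSet G} (g : T →[G] U) (f : S →[G] T) (a : IsoClass U) :
    pull (g.comp f) a = pull f (pull g a) := by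
  obtain ⟨X⟩ := a
  refine mk_eq (X := GSetOver.pull (g.comp f) X) (Y := GSetOver.pull f (GSetOver.pull g X))
    (fun q => ⟨(q.1.1, ⟨(f q.1.1, q.1.2), q.2⟩), rfl⟩) ⟨?_, ?_⟩ ?_ (fun _ => rfl)
  · rintro ⟨⟨s, x⟩, h⟩ ⟨⟨s', x'⟩, h'⟩ hx
    obtain ⟨hs, hx'⟩ := Prod.ext_iff.1 (Subtype.ext_iff.1 hx)
    obtain rfl : s = s' := hs
    obtain rfl : x = x' := (Prod.ext_iff.1 (Subtype.ext_iff.1 hx')).2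
    rfl
  · rintro ⟨⟨s, ⟨⟨t, x⟩, h⟩⟩, h'⟩
    obtain rfl : f s = t := h'
    exact ⟨⟨(s, x), h⟩, rfl⟩
  · intro a q
    exact Subtype.ext (Prod.ext rfl (Subtype.ext (Prod.ext (map_smul f a q.1.1) rfl)))

theorem pull_push {S S₁ S₂ T : FinGSet G} (Ψ : S →[G] S₁) (Φ : S →[G] S₂)
    (φ : S₁ →[G] T) (ψ : S₂ →[G] T) (hsq : IsPullbackSquare Ψ Φ φ ψ) (a : IsoClass S₂) :
    pull φ (push ψ a) = push Ψ (pull Φ a) := by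
  obtain ⟨X⟩ := a
  symm
  refine mk_eq (X := GSetOver.push Ψ (GSetOver.pull Φ X)) (Y := GSetOver.pull φ (GSetOver.push ψ X))
    (fun q => ⟨(Ψ q.1.1, q.1.2), (hsq.1 q.1.1).trans (congrArg ψ q.2)⟩) ⟨?_, ?_⟩ ?_ (fun _ => rfl)
  · rintro ⟨⟨s, x⟩, h⟩ ⟨⟨s', x'⟩, h'⟩ hx
    obtain ⟨hs, hx'⟩ := Prod.ext_iff.1 (Subtype.ext_iff.1 hx)
    obtain rfl : x = x' := hx'
    replace hs : Ψ s = Ψ s' := hs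
    have h0 : Φ s = X.hom x := h
    have h0' : Φ s' = X.hom x := h'
    obtain ⟨t, -, ht⟩ := hsq.2 (Ψ s) (Φ s) (hsq.1 s)
    have : s = s' := (ht s ⟨rfl, rfl⟩).trans (ht s' ⟨hs.symm, h0'.trans h0.symm⟩).symm
    subst this
    rfl
  · rintro ⟨⟨s₁, x⟩, h⟩
    obtain ⟨s, ⟨hs, hs'⟩, -⟩ := hsq.2 s₁ (X.hom x) h
    subst hs
    exact ⟨⟨(s, x), hs'⟩, rfl⟩
  · intro a q
    exact Subtype.ext (Prod.ext (map_smul Ψ a q.1.1) rfl)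

theorem eq_push_add_push {S T : FinGSet G} (a : IsoClass (sum S T)) :
    a = push (inl S T) (pull (inl S T) a) + push (inr S T) (pull (inr S T) a) := by
  obtain ⟨X⟩ := a
  symm
  refine mk_eq (X := (GSetOver.push (inl S T) (GSetOver.pull (inl S T) X)).sum
      (GSetOver.push (inr S T) (GSetOver.pull (inr S T) X))) (Y := X)
    (Sum.elim (fun q => q.1.2) (fun q => q.1.2)) ⟨?_, ?_⟩ ?_ ?_
  · rintro (⟨⟨s, x⟩, h⟩ | ⟨⟨s, x⟩, h⟩) (⟨⟨s', x'⟩, h'⟩ | ⟨⟨s', x'⟩, h'⟩) hx <;>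
      obtain rfl : x = x' := hx
    · obtain rfl : s = s' := Sum.inl_injective (h.trans h'.symm)
      rfl
    · exact absurd (h.trans h'.symm) Sum.inl_ne_inr
    · exact absurd (h.trans h'.symm) Sum.inr_ne_inl
    · obtain rfl : s = s' := Sum.inr_injective (h.trans h'.symm)
      rfl
  · intro x
    rcases h : X.hom x with s | s
    · exact ⟨Sum.inl ⟨(s, x), h.symm⟩, rfl⟩
    · exact ⟨Sum.inr ⟨(s, x), h.symm⟩, rfl⟩
  · rintro g (q | q) <;> rfl
  · rintro (q | q)
    · exact q.2.symm
    · exact q.2.symm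

theorem subsingleton_of_isEmpty (S : FinGSet G) [IsEmpty S] (a : IsoClass S) : a = 0 := by
  obtain ⟨X⟩ := a
  exact mk_eq (X := X) (Y := GSetOver.zero S) (fun x => isEmptyElim (X.hom x))
    ⟨fun x => isEmptyElim (X.hom x), fun x => isEmptyElim x⟩
    (fun _ x => isEmptyElim (X.hom x)) (fun x => isEmptyElim (X.hom x))

end IsoClass

open Algebra (GrothendieckAddGroup)

/-- The value `K₀` at `S` of the Burnside ring: the Grothendieck group of the monoid of isomorphism
classes of finite `G`-sets over `S` under disjoint union. -/
abbrev BurnsideObj (S : FinGSet G) : Type (u + 1) := GrothendieckAddGroup (IsoClass S)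

/-- The class in the Burnside ring of a finite `G`-set over `S`. -/
noncomputable def burnsideOf {S : FinGSet G} (X : GSetOver S) : BurnsideObj S :=
  GrothendieckAddGroup.of (IsoClass.mk X)

theorem burnsideObj_hom_ext {S : FinGSet G} {A : Type w} [AddCommGroup A] {f g : BurnsideObj S →+ A}
    (h : ∀ X : GSetOver S, f (burnsideOf X) = g (burnsideOf X)) : f = g := by
  apply GrothendieckAddGroup.lift.symm.injective
  ext a
  obtain ⟨X⟩ := a
  exact h X

/-- The map of Grothendieck groups induced by a map of monoids. -/
noncomputable def burnsideMap {S T : FinGSet G} (f : IsoClass S →+ IsoClass T) :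
    BurnsideObj S →+ BurnsideObj T :=
  GrothendieckAddGroup.lift (GrothendieckAddGroup.of.comp f)

theorem burnsideLift_mk {S : FinGSet G} {A : Type w} [AddCommGroup A] (f : IsoClass S →+ A)
    (X : GSetOver S) : GrothendieckAddGroup.lift f (burnsideOf X) = f (IsoClass.mk X) :=
  DFunLike.congr_fun (GrothendieckAddGroup.lift.symm_apply_apply f) (IsoClass.mk X)

theorem burnsideMap_mk {S T : FinGSet G} (f : IsoClass S →+ IsoClass T) (X : GSetOver S) :
    burnsideMap f (burnsideOf X) = GrothendieckAddGroup.of (f (IsoClass.mk X)) :=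
  burnsideLift_mk _ X

theorem burnsideMap_of {S T : FinGSet G} (f : IsoClass S →+ IsoClass T) (a : IsoClass S) :
    burnsideMap f (GrothendieckAddGroup.of a) = GrothendieckAddGroup.of (f a) := by
  obtain ⟨X⟩ := a
  exact burnsideMap_mk f X

variable (G) in
/-- The Burnside ring as a Mackey functor: the covariant maps are induced by composition, the
contravariant maps by pullback. -/
noncomputable def burnsideMackey : MackeyFunctor.{u, u + 1} G where
  obj S := BurnsideObj S
  ind φ := burnsideMap (IsoClass.push φ)
  res φ := burnsideMap (IsoClass.pull φ)
  ind_id S x := by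
    refine DFunLike.congr_fun (g := AddMonoidHom.id _) (burnsideObj_hom_ext fun X => ?_) x
    rw [burnsideMap_mk, IsoClass.push_id]
    rfl
  ind_comp g f x := by
    refine DFunLike.congr_fun (g := (burnsideMap _).comp (burnsideMap _))
      (burnsideObj_hom_ext fun X => ?_) x
    rw [AddMonoidHom.comp_apply, burnsideMap_mk, burnsideMap_mk, burnsideMap_of,
      IsoClass.push_comp]
  res_id S x := by
    refine DFunLike.congr_fun (g := AddMonoidHom.id _) (burnsideObj_hom_ext fun X => ?_) x
    rw [burnsideMap_mk, IsoClass.pull_id]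
    rfl
  res_comp g f x := by
    refine DFunLike.congr_fun (g := (burnsideMap _).comp (burnsideMap _))
      (burnsideObj_hom_ext fun X => ?_) x
    rw [AddMonoidHom.comp_apply, burnsideMap_mk, burnsideMap_mk, burnsideMap_of,
      IsoClass.pull_comp]
  res_ind Ψ Φ φ ψ h x := by
    refine DFunLike.congr_fun (f := (burnsideMap _).comp (burnsideMap _))
      (g := (burnsideMap _).comp (burnsideMap _)) (burnsideObj_hom_ext fun X => ?_) x
    rw [AddMonoidHom.comp_apply, AddMonoidHom.comp_apply, burnsideMap_mk, burnsideMap_mk,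
      burnsideMap_of, burnsideMap_of, IsoClass.pull_push _ _ _ _ h]
  additive S T := by
    have hsum : ∀ x : BurnsideObj (sum S T),
        x = burnsideMap (IsoClass.push (inl S T)) (burnsideMap (IsoClass.pull (inl S T)) x) +
          burnsideMap (IsoClass.push (inr S T)) (burnsideMap (IsoClass.pull (inr S T)) x) := by
      intro x
      refine DFunLike.congr_fun (f := AddMonoidHom.id _)
        (g := (burnsideMap _).comp (burnsideMap _) + (burnsideMap _).comp (burnsideMap _))
        (burnsideObj_hom_ext fun X => ?_) x
      simp only [AddMonoidHom.add_apply, AddMonoidHom.comp_apply, burnsideMap_mk,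
        burnsideMap_of]
      rw [← map_add, ← IsoClass.eq_push_add_push]
      rfl
    have hid : ∀ {U : FinGSet G} (i : U →[G] sum S T), Function.Injective i →
        ∀ x, burnsideMap (IsoClass.pull i) (burnsideMap (IsoClass.push i) x) = x := by
      intro U i hi x
      refine DFunLike.congr_fun (f := (burnsideMap _).comp (burnsideMap _))
        (g := AddMonoidHom.id _) (burnsideObj_hom_ext fun X => ?_) x
      rw [AddMonoidHom.comp_apply, burnsideMap_mk, burnsideMap_of,
        IsoClass.pull_push (MulActionHom.id G) (MulActionHom.id G) i i
          ⟨fun _ => rfl, fun s₁ s₂ hs => ⟨s₁, ⟨rfl, hi hs⟩, fun t ht => ht.1⟩⟩,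
        IsoClass.pull_id, IsoClass.push_id]
      rfl
    have hzero : ∀ {U V : FinGSet G} (i : U →[G] sum S T) (j : V →[G] sum S T),
        (∀ s t, i s ≠ j t) →
        ∀ x, burnsideMap (IsoClass.pull i) (burnsideMap (IsoClass.push j) x) = 0 := by
      intro U V i j hij x
      refine DFunLike.congr_fun (f := (burnsideMap _).comp (burnsideMap _))
        (g := 0) (burnsideObj_hom_ext fun X => ?_) x
      rw [AddMonoidHom.comp_apply, burnsideMap_mk, burnsideMap_of,
        IsoClass.pull_push (MackeyFunctor.fromEmpty U) (MackeyFunctor.fromEmpty V) i j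
          ⟨fun x => isEmptyElim x, fun s₁ s₂ hs => (hij _ _ hs).elim⟩,
        IsoClass.subsingleton_of_isEmpty (FinGSet.empty G) (IsoClass.pull _ _), map_zero, map_zero]
      rfl
    have hl : Function.Injective (inl S T) := Sum.inl_injective
    have hr : Function.Injective (inr S T) := Sum.inr_injective
    constructor
    · intro x y hxy
      rw [hsum x, hsum y]
      exact congrArg₂ _ (congrArg _ (congrArg Prod.fst hxy)) (congrArg _ (congrArg Prod.snd hxy))
    · rintro ⟨x, y⟩
      refine ⟨burnsideMap (IsoClass.push (inl S T)) x + burnsideMap (IsoClass.push (inr S T)) y,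
        Prod.ext ?_ ?_⟩
      · simp only [map_add]
        rw [hid _ hl, hzero _ _ fun _ _ => Sum.inl_ne_inr, add_zero]
      · simp only [map_add]
        rw [hid _ hr, hzero _ _ fun _ _ => Sum.inr_ne_inl, zero_add]
  obj_empty := by
    refine ⟨fun x y => ?_⟩
    have h : AddMonoidHom.id (BurnsideObj (FinGSet.empty G)) = 0 :=
      burnsideObj_hom_ext fun X => by
        have : IsoClass.mk X = 0 := IsoClass.subsingleton_of_isEmpty _ _
        simp [burnsideOf, this]
    exact (DFunLike.congr_fun h x).trans (DFunLike.congr_fun h y).symm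

/-- The class in the Burnside ring of a finite `G`-set over `S`. -/
noncomputable def burnsideClass {S : FinGSet G} (X : GSetOver S) : (burnsideMackey G).obj S :=
  burnsideOf X

theorem burnside_hom_ext {S : FinGSet G} {A : Type w} [AddCommGroup A]
    {f g : (burnsideMackey G).obj S →+ A}
    (h : ∀ X : GSetOver S, f (burnsideClass X) = g (burnsideClass X)) : f = g :=
  burnsideObj_hom_ext h

/-- The action of the Burnside ring on a Mackey functor: the class of `(X, f)` sends `x` to
`f_* (f^* x)`. -/
noncomputable def burnsideAct (M : MackeyFunctor.{u, w} G) (S : FinGSet G) :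
    (burnsideMackey G).obj S →+ M.obj S →+ M.obj S :=
  GrothendieckAddGroup.lift
    { toFun := Quotient.lift
        (fun X : GSetOver S => (M.ind X.hom).comp (M.res X.hom)) (by
          rintro X Y ⟨e, he, h⟩
          ext x
          simp only [AddMonoidHom.comp_apply, ← h, M.ind_comp, M.res_comp,
            M.ind_res_of_bijective e he])
      map_zero' := by
        have := M.obj_empty
        ext x
        change M.ind (GSetOver.zero S).hom (M.res (GSetOver.zero S).hom x) = 0
        have h0 : M.res (GSetOver.zero S).hom x = 0 := M.obj_empty.elim _ _
        rw [h0, map_zero]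
      map_add' := by
        rintro ⟨X⟩ ⟨Y⟩
        ext x
        change M.ind (desc X.hom Y.hom) (M.res (desc X.hom Y.hom) x) =
          M.ind X.hom (M.res X.hom x) + M.ind Y.hom (M.res Y.hom x)
        have h1 : (desc X.hom Y.hom).comp (inl X.total Y.total) = X.hom := rfl
        have h2 : (desc X.hom Y.hom).comp (inr X.total Y.total) = Y.hom := rfl
        rw [M.eq_ind_add_ind (M.res (desc X.hom Y.hom) x), map_add, ← M.ind_comp, ← M.ind_comp,
          ← M.res_comp, ← M.res_comp, h1, h2] }

theorem burnsideAct_class (M : MackeyFunctor.{u, w} G) {S : FinGSet G} (X : GSetOver S)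
    (x : M.obj S) : burnsideAct M S (burnsideClass X) x = M.ind X.hom (M.res X.hom x) :=
  DFunLike.congr_fun (burnsideLift_mk _ X) x

theorem burnsideMackey_ind_class {S T : FinGSet G} (φ : S →[G] T) (X : GSetOver S) :
    (burnsideMackey G).ind φ (burnsideClass X) = burnsideClass (GSetOver.push φ X) :=
  burnsideMap_mk _ X

theorem burnsideMackey_res_class {S T : FinGSet G} (φ : S →[G] T) (X : GSetOver T) :
    (burnsideMackey G).res φ (burnsideClass X) = burnsideClass (GSetOver.pull φ X) :=
  burnsideMap_mk _ X

/-- The action of the Burnside ring on a Mackey functor is a pairing. -/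
noncomputable def burnsidePairing (M : MackeyFunctor.{u, w} G) :
    Pairing (burnsideMackey G) M M where
  pair := burnsideAct M
  res_pair {S T} φ a y := by
    refine DFunLike.congr_fun (f := (M.res φ).comp ((burnsideAct M T).flip y))
      (g := ((burnsideAct M S).flip (M.res φ y)).comp ((burnsideMackey G).res φ))
      (burnside_hom_ext fun X => ?_) a
    simp only [AddMonoidHom.comp_apply, AddMonoidHom.flip_apply, burnsideMackey_res_class,
      burnsideAct_class]
    rw [M.res_ind _ _ _ _ (isPullbackSquare_pullback φ X.hom), ← M.res_comp, ← M.res_comp]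
    have : X.hom.comp (pullbackSnd φ X.hom) = φ.comp (pullbackFst φ X.hom) := by
      ext q; exact q.2.symm
    rw [this]
  pair_ind {S T} φ a y := by
    refine DFunLike.congr_fun (f := (burnsideAct M T).flip (M.ind φ y))
      (g := (M.ind φ).comp (((burnsideAct M S).flip y).comp ((burnsideMackey G).res φ)))
      (burnside_hom_ext fun X => ?_) a
    simp only [AddMonoidHom.comp_apply, AddMonoidHom.flip_apply, burnsideMackey_res_class,
      burnsideAct_class]
    have hsq : IsPullbackSquare (pullbackSnd φ X.hom) (pullbackFst φ X.hom) X.hom φ :=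
      ⟨fun q => q.2.symm, fun s t h => ⟨⟨(t, s), h.symm⟩, ⟨rfl, rfl⟩,
        fun q hq => Subtype.ext (Prod.ext hq.2 hq.1)⟩⟩
    rw [M.res_ind _ _ _ _ hsq, ← M.ind_comp]
    have : X.hom.comp (pullbackSnd φ X.hom) = φ.comp (pullbackFst φ X.hom) := by
      ext q; exact q.2.symm
    rw [this, M.ind_comp]
  ind_pair {S T} φ a y := by
    refine DFunLike.congr_fun
      (f := ((burnsideAct M T).flip y).comp ((burnsideMackey G).ind φ))
      (g := (M.ind φ).comp ((burnsideAct M S).flip (M.res φ y)))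
      (burnside_hom_ext fun X => ?_) a
    simp only [AddMonoidHom.comp_apply, AddMonoidHom.flip_apply, burnsideMackey_ind_class,
      burnsideAct_class]
    rw [← M.res_comp, ← M.ind_comp]

theorem burnsideAct_id (M : MackeyFunctor.{u, w} G) (S : FinGSet G) (x : M.obj S) :
    burnsideAct M S (burnsideClass (GSetOver.id S)) x = x := by
  rw [burnsideAct_class]
  change M.ind (MulActionHom.id G) (M.res (MulActionHom.id G) x) = x
  rw [M.res_id, M.ind_id]

theorem burnsideAct_act (M : MackeyFunctor.{u, w} G) (S : FinGSet G)
    (a b : (burnsideMackey G).obj S) (x : M.obj S) :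
    burnsideAct M S (burnsideAct (burnsideMackey G) S a b) x =
      burnsideAct M S a (burnsideAct M S b x) := by
  refine DFunLike.congr_fun
    (f := ((burnsideAct M S).flip x).comp ((burnsideAct (burnsideMackey G) S).flip b))
    (g := (burnsideAct M S).flip (burnsideAct M S b x))
    (burnside_hom_ext fun X => ?_) a
  simp only [AddMonoidHom.comp_apply, AddMonoidHom.flip_apply]
  rw [burnsideAct_class, burnsideAct_class]
  exact ((burnsidePairing M).ind_pair X.hom _ _).trans
    (congrArg _ ((burnsidePairing M).res_pair X.hom b x).symm)

variable (G) in
/-- The Burnside ring as a Green ring. The product of the classes of `(X, f)` and `(Y, g)` is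
`f_* (f^* [Y, g])`, which is the class of the pullback of `f` and `g` over `S`. -/
noncomputable def burnside : GreenRing.{u, u + 1} G where
  toMackey := burnsideMackey G
  mul := burnsidePairing (burnsideMackey G)
  one S := burnsideClass (GSetOver.id S)
  mul_assoc := burnsideAct_act (burnsideMackey G)
  one_mul := burnsideAct_id (burnsideMackey G)
  mul_one S x := by
    refine DFunLike.congr_fun (g := AddMonoidHom.id ((burnsideMackey G).obj S))
      (f := (burnsideAct (burnsideMackey G) S).flip (burnsideClass (GSetOver.id S)))
      (burnside_hom_ext fun X => ?_) x
    rw [AddMonoidHom.flip_apply, burnsideAct_class, burnsideMackey_res_class,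
      burnsideMackey_ind_class]
    refine congrArg GrothendieckAddGroup.of ?_
    refine IsoClass.mk_eq (X := GSetOver.push X.hom (GSetOver.pull X.hom (GSetOver.id S))) (Y := X)
      (fun q => q.1.1) ⟨?_, ?_⟩ (fun _ _ => rfl) (fun _ => rfl)
    · rintro ⟨⟨x, s⟩, h⟩ ⟨⟨x', s'⟩, h'⟩ hx
      obtain rfl : x = x' := hx
      exact Subtype.ext (Prod.ext rfl (h.symm.trans h'))
    · intro x
      exact ⟨⟨(x, X.hom x), rfl⟩, rfl⟩
  res_one {S T} φ := by
    rw [burnsideMackey_res_class]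
    refine congrArg GrothendieckAddGroup.of ?_
    refine IsoClass.mk_eq (X := GSetOver.pull φ (GSetOver.id T)) (Y := GSetOver.id S)
      (fun q => q.1.1) ⟨?_, ?_⟩ (fun _ _ => rfl) (fun _ => rfl)
    · rintro ⟨⟨x, s⟩, h⟩ ⟨⟨x', s'⟩, h'⟩ hx
      obtain rfl : x = x' := hx
      exact Subtype.ext (Prod.ext rfl (h.symm.trans h'))
    · intro x
      exact ⟨⟨(x, φ x), rfl⟩, rfl⟩

/-- The canonical Green module structure over the Burnside ring on a Mackey functor. -/
noncomputable def burnsideModule (M : MackeyFunctor.{u, w} G) : GreenModule (burnside G) M where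
  toPairing := burnsidePairing M
  mul_pair := burnsideAct_act M
  one_pair := burnsideAct_id M

/-- The Burnside quotient Green ring of a Mackey functor `M`: the quotient of the Burnside ring by
the Green ideal of its canonical Green module `M`. -/
noncomputable def burnsideQuotient (M : MackeyFunctor.{u, w} G) : GreenRing.{u, u + 1} G :=
  (burnside G).quotient (burnsideModule M).annihilator

end Burnside

/-! ### Families of subgroups and Dress generating sets -/

/-- A family of subgroups of `G`, closed under conjugation and under passing to subgroups. -/
structure SubgroupFamily (G : Type u) [Group G] where
  carrier : Set (Subgroup G)
  conj_mem : ∀ {H : Subgroup G}, H ∈ carrier → ∀ g : G,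
    H.map (MulAut.conj g).toMonoidHom ∈ carrier
  mem_of_le : ∀ {K H : Subgroup G}, K ≤ H → H ∈ carrier → K ∈ carrier

/-- The subgroup `O^p(H)`: the intersection of all normal subgroups of `H` whose quotient is a
`p`-group. -/
def pResidual (p : ℕ) (H : Type v) [Group H] : Subgroup H :=
  sInf {N : Subgroup H | ∃ _ : N.Normal, IsPGroup p (H ⧸ N)}

theorem pResidual_map_le (p : ℕ) {K : Type v} {H : Type w} [Group K] [Group H] (f : K →* H) :
    (pResidual p K).map f ≤ pResidual p H := by
  refine le_sInf ?_
  rintro N ⟨hN, hp⟩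
  rw [Subgroup.map_le_iff_le_comap]
  refine sInf_le ⟨inferInstance, ?_⟩
  refine hp.of_injective (QuotientGroup.map (N.comap f) N f le_rfl) ?_
  rw [← MonoidHom.ker_eq_bot_iff, QuotientGroup.ker_map, QuotientGroup.map_mk'_self]

section Families

variable {G : Type u} [Group G]

namespace SubgroupFamily

/-- The family generated by the isotropy subgroups of `X`. -/
def isotropy (X : FinGSet G) : SubgroupFamily G where
  carrier := {H | ∃ x : X, H ≤ MulAction.stabilizer G x}
  conj_mem := by
    rintro H ⟨x, hx⟩ g
    refine ⟨g • x, ?_⟩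
    rw [MulAction.stabilizer_smul_eq_stabilizer_map_conj]
    exact Subgroup.map_mono hx
  mem_of_le := by
    rintro K H h ⟨x, hx⟩
    exact ⟨x, h.trans hx⟩

/-- The family of all subgroups `H` of `G` such that `O^p(H)` belongs to `F`. -/
def hyper (p : ℕ) (F : SubgroupFamily G) : SubgroupFamily G where
  carrier := {H | (pResidual p H).map H.subtype ∈ F.carrier}
  conj_mem := by
    intro H hH g
    refine F.mem_of_le ?_ (F.conj_mem hH g)
    rw [Subgroup.map_map]
    set c := (MulAut.conj g).toMonoidHom
    have hinj : Function.Injective c := (MulAut.conj g).injective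
    let e : H ≃* H.map c := H.equivMapOfInjective c hinj
    have h1 := Subgroup.map_mono (f := c.comp H.subtype)
      (pResidual_map_le p e.symm.toMonoidHom)
    rw [Subgroup.map_map] at h1
    have h2 : (c.comp H.subtype).comp e.symm.toMonoidHom = (H.map c).subtype := by
      ext x
      obtain ⟨y, rfl⟩ := e.surjective x
      simp [e]
    rwa [h2] at h1
  mem_of_le := by
    intro K H h hH
    refine F.mem_of_le ?_ hH
    have h1 := Subgroup.map_mono (f := H.subtype) (pResidual_map_le p (Subgroup.inclusion h))
    rwa [Subgroup.map_map] at h1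

/-- Conjugacy of maximal elements of a family of subgroups. -/
def maximalConj (F : SubgroupFamily G) :
    Setoid {H : Subgroup G // Maximal (· ∈ F.carrier) H} where
  r H K := ∃ g : G, K.1 = H.1.map (MulAut.conj g).toMonoidHom
  iseqv :=
    { refl := fun H => ⟨1, by ext; simp⟩
      symm := by
        rintro H K ⟨g, h⟩
        refine ⟨g⁻¹, ?_⟩
        rw [h, Subgroup.map_map]
        ext x
        simp [Subgroup.mem_map, mul_assoc]
      trans := by
        rintro H K L ⟨g, h⟩ ⟨g', h'⟩
        refine ⟨g' * g, ?_⟩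
        rw [h', h, Subgroup.map_map]
        congr 1
        ext x
        simp [mul_assoc] }

/-- The finite `G`-set of a family of subgroups: the disjoint union of the `G`-sets `G ⧸ H`, one
for each conjugacy class of maximal elements `H` of the family. -/
noncomputable def toGSet [Finite G] (F : SubgroupFamily G) : FinGSet G where
  carrier := Σ c : Quotient F.maximalConj, G ⧸ (c.out.1 : Subgroup G)

end SubgroupFamily

/-- The finite `G`-set `hyper_p`-`X`. -/
noncomputable def hyperGSet [Finite G] (p : ℕ) (X : FinGSet G) : FinGSet G :=
  ((SubgroupFamily.isotropy X).hyper p).toGSet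

end Families

instance isPrime_span_natCast (p : ℕ) [hp : Fact p.Prime] : (Ideal.span {(p : ℤ)}).IsPrime :=
  (Ideal.span_singleton_prime (by exact_mod_cast hp.out.ne_zero)).2
    (Nat.prime_iff_prime_int.1 hp.out)

/-- The integers localized at the prime `p`. -/
abbrev ZLocal (p : ℕ) [Fact p.Prime] : Type := Localization.AtPrime (Ideal.span {(p : ℤ)})

open scoped TensorProduct in
/-- `X` is a Dress generating set for the Green ring `R`: for each prime `p`, the projection of
`hyper_p`-`X` to a point induces a surjection `R(hyper_p-X) ⊗ ℤ_(p) → R(pt) ⊗ ℤ_(p)`. -/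
def IsDressGeneratingSet {G : Type u} [Group G] [Finite G] (R : GreenRing.{u, w} G)
    (X : FinGSet G) : Prop :=
  ∀ (p : ℕ) [Fact p.Prime], Function.Surjective
    (LinearMap.rTensor (ZLocal p) (R.toMackey.ind (hyperGSet p X).toPoint).toIntLinearMap :
      R.toMackey.obj (hyperGSet p X) ⊗[ℤ] ZLocal p →ₗ[ℤ] R.toMackey.obj (point G) ⊗[ℤ] ZLocal p)

end DressInduction

namespace DressInduction

/-! ### Surjectivity after localization at a prime -/

section Localization

variable {M : Type v} {N : Type w} [AddCommGroup M] [AddCommGroup N]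

/-! Fix a prime `p`, let S be hyper_p-X, A the Burnside ring and I the annihilator ideal of 𝒢.
Surjectivity over ℤ_(p) means that every element of the target has a multiple by an integer prime to
`p` in the image. By Frobenius reciprocity, ind(a)·y = ind(a·res y), it suffices to reach such a
multiple of the unit.

If A/I has the property, then k - ind(a) lies in I for some k prime to `p`, hence kills 𝒢(•), and ky
= ind(a·res y) for every y in 𝒢(•).

Conversely, let k·1 = ind(x) in 𝒢(•). Dress's theorem for A itself
(`exists_res_intCast_sub_ind_eq_zero`) gives l prime to `p` and a in A(S) such that c = l - ind(a)
restricts to zero on S. Then c·(k·1) = c·ind(x) = ind(res(c)·x) = 0. An element of A(•) that kills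
the unit of 𝒢 lies in I (`GreenRing.mem_annihilator_of_act_one`), so kc is in I, and kl·1 is induced
from S modulo I.

Dress's theorem has two ingredients. The first is a triangularity statement: on transitive G-sets
over S with isotropy group H, an element r of A(•) acts as its mark φ_H(r), up to smaller isotropy.
So a power of ∏ (φ_H(r) - r), taken over the subgroups H of isotropy groups of S, restricts to zero
on S. If r is induced from S, this power is congruent to the integer (∏ φ_H(r))^n modulo induced
elements. The second is that r can be chosen with all these marks prime to `p`. Prime avoidance
reduces this to finding, for each H, an induced element with φ_H prime to `p`. The coset space G/M
serves, where M/Q is a Sylow `p`-subgroup of N(Q)/Q and Q = O^p(H). -/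

theorem mem_primeCompl_span_natCast (p : ℕ) [Fact p.Prime] (k : ℤ) :
    k ∈ (Ideal.span {(p : ℤ)}).primeCompl ↔ ¬ (p : ℤ) ∣ k := by
  rw [Ideal.mem_primeCompl_iff, Ideal.mem_span_singleton]

theorem isLocalizedModule_tmul_one (S : Submonoid ℤ) (A : Type u) [CommRing A]
    [IsLocalization S A] (N : Type w) [AddCommGroup N] :
    IsLocalizedModule S ((TensorProduct.mk ℤ N A).flip 1) := by
  have h : IsLocalizedModule S (TensorProduct.mk ℤ A N 1) :=
    (isLocalizedModule_iff_isBaseChange S A _).2 (TensorProduct.isBaseChange ℤ N A)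
  exact IsLocalizedModule.of_linearEquiv S (TensorProduct.mk ℤ A N 1) (TensorProduct.comm ℤ A N)

open scoped TensorProduct in
/-- A homomorphism of abelian groups is surjective after localization at `S` if and only if every
element of its target has a multiple by an element of `S` in its range. -/
theorem rTensor_localization_surjective_iff (S : Submonoid ℤ) (A : Type u) [CommRing A]
    [IsLocalization S A] (f : M →+ N) :
    Function.Surjective (LinearMap.rTensor A f.toIntLinearMap) ↔
      ∀ y : N, ∃ k ∈ S, ∃ x : M, f x = k • y := by
  constructor
  · intro hf y
    obtain ⟨z, hz⟩ := hf (y ⊗ₜ 1)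
    have hM := isLocalizedModule_tmul_one S A M
    have hN := isLocalizedModule_tmul_one S A N
    obtain ⟨⟨x, s⟩, hx⟩ := hM.surj z
    have h : ((TensorProduct.mk ℤ N A).flip 1) ((s : ℤ) • y) =
        ((TensorProduct.mk ℤ N A).flip 1) (f x) := by
      have h1 := congrArg (LinearMap.rTensor A f.toIntLinearMap) hx
      rw [Submonoid.smul_def, map_smul, hz] at h1
      rw [map_smul]
      exact h1
    -- Clearing the denominator `s` of the preimage gives an equality only after localization; a
    -- second factor `c` makes it hold in `N` itself.
    obtain ⟨c, hc⟩ := hN.exists_of_eq h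
    refine ⟨(c * s : S), (c * s).2, (c : ℤ) • x, ?_⟩
    rw [map_zsmul, Submonoid.coe_mul, mul_smul]
    exact hc.symm
  · intro h z
    induction z using TensorProduct.induction_on with
    | zero => exact ⟨0, map_zero _⟩
    | add a b ha hb =>
      obtain ⟨a', rfl⟩ := ha
      obtain ⟨b', rfl⟩ := hb
      exact ⟨a' + b', map_add _ _ _⟩
    | tmul y q =>
      obtain ⟨k, hk, x, hx⟩ := h y
      -- Since `f x = k • y`, a preimage of y ⊗ q is x ⊗ q/k.
      have hq : k • (IsLocalization.mk' A (1 : ℤ) (⟨k, hk⟩ : S) * q) = q := by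
        rw [← smul_mul_assoc, Algebra.smul_def, mul_comm (algebraMap ℤ A k),
          IsLocalization.mk'_spec A (1 : ℤ) (⟨k, hk⟩ : S), map_one, one_mul]
      refine ⟨x ⊗ₜ (IsLocalization.mk' A (1 : ℤ) (⟨k, hk⟩ : S) * q), ?_⟩
      rw [LinearMap.rTensor_tmul]
      change f x ⊗ₜ[ℤ] _ = _
      rw [hx, TensorProduct.smul_tmul, hq]

theorem rTensor_zLocal_surjective_iff (p : ℕ) [Fact p.Prime] (f : M →+ N) :
    Function.Surjective (LinearMap.rTensor (ZLocal p) f.toIntLinearMap) ↔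
      ∀ y : N, ∃ k : ℤ, ¬ (p : ℤ) ∣ k ∧ ∃ x : M, f x = k • y := by
  -- The localization carries its own ℤ-algebra structure besides the one every ring has; the two
  -- agree because ℤ-algebra structures are unique.
  have hloc : @IsLocalization _ _ (Ideal.span {(p : ℤ)}).primeCompl (ZLocal p) _
      (Ring.toIntAlgebra (ZLocal p)) := by
    rw [Subsingleton.elim (Ring.toIntAlgebra (ZLocal p)) OreLocalization.instAlgebra]
    infer_instance
  simp only [← mem_primeCompl_span_natCast]
  exact rTensor_localization_surjective_iff (Ideal.span {(p : ℤ)}).primeCompl (ZLocal p) f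

end Localization

theorem isDressGeneratingSet_iff {G : Type u} [Group G] [Finite G] (R : GreenRing.{u, w} G)
    (X : FinGSet G) : IsDressGeneratingSet R X ↔ ∀ p : ℕ, p.Prime → ∀ y, ∃ k : ℤ,
      ¬ (p : ℤ) ∣ k ∧ ∃ x, R.toMackey.ind (hyperGSet p X).toPoint x = k • y := by
  constructor
  · intro h p hp
    have : Fact p.Prime := ⟨hp⟩
    exact (rTensor_zLocal_surjective_iff p _).1 (h p)
  · intro h p hp
    exact (rTensor_zLocal_surjective_iff p _).2 (h p hp.out)

/-! ### The residual of a subgroup and marks of coset spaces -/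

section Residual

variable {G : Type u} [Group G]

/-- `Q` is a normal subgroup of `K` whose quotient is a `p`-group. -/
structure IsPNormal (p : ℕ) (Q K : Subgroup G) : Prop where
  le : Q ≤ K
  le_normalizer : K ≤ Subgroup.normalizer (Q : Set G)
  exists_pow_mem : ∀ x ∈ K, ∃ n : ℕ, x ^ p ^ n ∈ Q

/-- The residual `O^p(K)`, as a subgroup of the ambient group. -/
def residual (p : ℕ) (K : Subgroup G) : Subgroup G := (pResidual p K).map K.subtype

theorem residual_le (p : ℕ) (K : Subgroup G) : residual p K ≤ K := Subgroup.map_subtype_le _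

/-- Functoriality of O^p. With `f` a conjugation it makes the residual invariant under the
normalizer; it also confines conjugates of O^p-perfect subgroups. -/
theorem map_residual_le {G' : Type v} [Group G'] (p : ℕ) (f : G →* G') {K : Subgroup G}
    {L : Subgroup G'} (h : K.map f ≤ L) : (residual p K).map f ≤ residual p L := by
  let f' : K →* L := (f.comp K.subtype).codRestrict L
    fun x => h (Subgroup.mem_map_of_mem f x.2)
  have h1 := Subgroup.map_mono (f := L.subtype) (pResidual_map_le p f')
  rw [Subgroup.map_map] at h1
  rw [residual, Subgroup.map_map]
  exact h1

theorem IsPNormal.residual_le {p : ℕ} {Q K : Subgroup G} (h : IsPNormal p Q K) :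
    residual p K ≤ Q := by
  have hn : (Q.subgroupOf K).Normal := Subgroup.normal_subgroupOf_iff_le_normalizer h.le |>.2
    h.le_normalizer
  have h1 : pResidual p K ≤ Q.subgroupOf K := by
    refine sInf_le ⟨hn, fun x => ?_⟩
    induction x using QuotientGroup.induction_on with
    | H x =>
      obtain ⟨n, hn⟩ := h.exists_pow_mem x x.2
      exact ⟨n, (QuotientGroup.eq_one_iff (x ^ p ^ n)).2 hn⟩
  exact (Subgroup.map_mono h1).trans (by simp [Subgroup.subgroupOf_map_subtype])

theorem le_normalizer_of_map_le {K Q : Subgroup G}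
    (h : ∀ x ∈ K, Q.map (MulAut.conj x).toMonoidHom ≤ Q) :
    K ≤ Subgroup.normalizer (Q : Set G) := by
  intro x hx
  refine Subgroup.mem_normalizer_iff.2 fun y => ⟨fun hy => ?_, fun hy => ?_⟩
  · exact h x hx (Subgroup.mem_map_of_mem _ hy)
  · have := h x⁻¹ (inv_mem hx) (Subgroup.mem_map_of_mem _ hy)
    simpa [mul_assoc] using this

theorem map_conj_le_of_mem_normalizer {Q : Subgroup G} {x : G}
    (hx : x ∈ Subgroup.normalizer (Q : Set G)) :
    Q.map (MulAut.conj x).toMonoidHom ≤ Q := by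
  rintro _ ⟨y, hy, rfl⟩
  exact (Subgroup.mem_normalizer_iff.1 hx y).1 hy

/-- If `Q` is normal in `M` with quotient a `p`-group, then `Q` contains every conjugate of
`Q = O^p(Q)` that is contained in `M`. -/
theorem IsPNormal.map_conj_le {p : ℕ} {Q M : Subgroup G} (h : IsPNormal p Q M)
    (hQ : residual p Q = Q) {g : G} (hg : Q.map (MulAut.conj g).toMonoidHom ≤ M) :
    Q.map (MulAut.conj g).toMonoidHom ≤ Q := by
  calc Q.map (MulAut.conj g).toMonoidHom = (residual p Q).map (MulAut.conj g).toMonoidHom := by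
        rw [hQ]
    _ ≤ residual p M := map_residual_le p _ hg
    _ ≤ Q := h.residual_le

variable [Finite G]

/-- An intersection of infinitely many subgroups of `p`-power index need not have a `p`-group
quotient. Here only finitely many occur, so the exponents that they require of an element have a
common bound. -/
theorem isPNormal_residual (p : ℕ) (K : Subgroup G) : IsPNormal p (residual p K) K where
  le := residual_le p K
  le_normalizer := le_normalizer_of_map_le fun x hx =>
    map_residual_le p _ (map_conj_le_of_mem_normalizer (Subgroup.le_normalizer hx))
  exists_pow_mem x hx := by
    let S := {N : Subgroup K | ∃ _ : N.Normal, IsPGroup p (K ⧸ N)}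
    have h : ∀ N : S, ∃ n : ℕ, (⟨x, hx⟩ : K) ^ p ^ n ∈ N.1 := by
      rintro ⟨N, hN, hp⟩
      obtain ⟨n, hn⟩ := hp ((⟨x, hx⟩ : K) : K ⧸ N)
      exact ⟨n, (QuotientGroup.eq_one_iff _).1 hn⟩
    choose n hn using h
    obtain ⟨m, hm⟩ := Finite.exists_le n
    refine ⟨m, Subgroup.mem_map.2 ⟨(⟨x, hx⟩ : K) ^ p ^ m, ?_, rfl⟩⟩
    refine Subgroup.mem_sInf.2 fun N hN => ?_
    obtain ⟨d, hd⟩ := Nat.exists_eq_add_of_le (hm ⟨N, hN⟩)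
    rw [hd, pow_add, pow_mul]
    exact pow_mem (hn ⟨N, hN⟩) _

/-- O^p(O^p(K)) is invariant under conjugation by `K`, and an extension of a `p`-group by a
`p`-group is a `p`-group, so minimality of O^p(K) applies. -/
theorem residual_residual (p : ℕ) (K : Subgroup G) :
    residual p (residual p K) = residual p K := by
  refine le_antisymm (residual_le p _) (IsPNormal.residual_le ?_)
  have h1 := isPNormal_residual p K
  have h2 := isPNormal_residual p (residual p K)
  refine ⟨h2.le.trans h1.le, le_normalizer_of_map_le fun x hx => map_residual_le p _
    (map_conj_le_of_mem_normalizer (h1.le_normalizer hx)), fun x hx => ?_⟩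
  obtain ⟨n, hn⟩ := h1.exists_pow_mem x hx
  obtain ⟨m, hm⟩ := h2.exists_pow_mem _ hn
  exact ⟨n + m, by rwa [pow_add, pow_mul]⟩

end Residual

/-! ### Fixed points on coset spaces, and the isotropy groups of the `G`-set of a family. -/

section Marks

variable {G : Type u} [Group G]

/-- The points of `Z` that are fixed by the subgroup `H`. -/
def fixedPts (H : Subgroup G) (Z : Type v) [MulAction G Z] : Set Z := {z | ∀ h ∈ H, h • z = z}

/-- `H` acts on the `Q`-fixed points through a `p`-group, whose orbits are single points or have
size divisible by `p`. The image in the permutation group takes the place of H/Q. -/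
theorem card_fixedPts_modEq {p : ℕ} [Fact p.Prime] {Q H : Subgroup G} (h : IsPNormal p Q H)
    (Z : Type v) [MulAction G Z] [Finite Z] :
    Nat.card (fixedPts Q Z) ≡ Nat.card (fixedPts H Z) [MOD p] := by
  let act : MulAction H (fixedPts Q Z) :=
    { smul := fun x z => ⟨(x : G) • z.1, fun q hq => by
        have hq' : (x : G)⁻¹ * q * x ∈ Q := by
          have := (Subgroup.mem_normalizer_iff.1 (h.le_normalizer (inv_mem x.2)) q).1 hq
          simpa using this
        have := z.2 _ hq'
        rw [mul_smul, mul_smul, inv_smul_eq_iff] at this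
        exact this⟩
      one_smul := fun z => Subtype.ext (one_smul G z.1)
      mul_smul := fun x y z => Subtype.ext (mul_smul (x : G) (y : G) z.1) }
  let R := (MulAction.toPermHom H (fixedPts Q Z)).range
  have hR : IsPGroup p R := by
    rintro ⟨_, x, rfl⟩
    obtain ⟨n, hn⟩ := h.exists_pow_mem x x.2
    refine ⟨n, Subtype.ext ?_⟩
    change MulAction.toPermHom H (fixedPts Q Z) x ^ p ^ n = 1
    rw [← map_pow]
    ext z
    exact z.2 _ hn
  refine (hR.card_modEq_card_fixedPoints (fixedPts Q Z)).trans ?_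
  have : Nat.card (MulAction.fixedPoints R (fixedPts Q Z)) = Nat.card (fixedPts H Z) := by
    refine Nat.card_congr
      { toFun := fun z => ⟨z.1.1, fun x hx => ?_⟩
        invFun := fun z => ⟨⟨z.1, fun q hq => z.2 q (h.le hq)⟩, ?_⟩
        left_inv := fun _ => rfl
        right_inv := fun _ => rfl }
    · exact congrArg Subtype.val (z.2 ⟨MulAction.toPermHom H (fixedPts Q Z) ⟨x, hx⟩, ⟨x, hx⟩, rfl⟩)
    · rintro ⟨_, x, rfl⟩
      exact Subtype.ext (z.2 x x.2)
  rw [this]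

variable [Finite G]

/-- The coset gM is fixed by `Q` exactly when g⁻¹Qg ≤ M. As Q = O^p(Q) and O^p(M) ≤ Q, this forces g
to normalize `Q`, so the fixed points form the orbit N(Q)/M. -/
theorem card_fixedPts_quotient {p : ℕ} {Q M : Subgroup G} (h : IsPNormal p Q M)
    (hQ : residual p Q = Q) :
    Nat.card (fixedPts Q (G ⧸ M)) = M.relIndex (Subgroup.normalizer (Q : Set G)) := by
  let N := Subgroup.normalizer (Q : Set G)
  have h1 : fixedPts Q (G ⧸ M) = MulAction.orbit N ((1 : G) : G ⧸ M) := by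
    ext z
    induction z using QuotientGroup.induction_on with
    | H g =>
      have key : ((g : G ⧸ M) ∈ fixedPts Q (G ⧸ M)) ↔ g⁻¹ ∈ N := by
        constructor
        · intro hg
          have h2 : Q.map (MulAut.conj g⁻¹).toMonoidHom ≤ Q := by
            refine h.map_conj_le hQ ?_
            rintro _ ⟨q, hq, rfl⟩
            -- Using `q⁻¹` yields (q⁻¹g)⁻¹g = g⁻¹qg in `M`, with no further inversion.
            have := QuotientGroup.eq.1 (hg q⁻¹ (inv_mem hq))
            simpa [mul_assoc] using this
          have h3 : Q.map (MulAut.conj g⁻¹).toMonoidHom = Q :=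
            Subgroup.eq_of_le_of_card_ge h2
              (Subgroup.card_map_of_injective (MulAut.conj g⁻¹).injective).ge
          refine Subgroup.mem_normalizer_iff.2 fun y => ⟨fun hy => ?_, fun hy => ?_⟩
          · exact h2 (Subgroup.mem_map_of_mem _ hy)
          · rw [← SetLike.mem_coe, ← h3] at hy
            obtain ⟨y', hy', e⟩ := hy
            obtain rfl := (MulAut.conj g⁻¹).injective e
            exact hy'
        · intro hg q hq
          refine QuotientGroup.eq.2 (h.le ?_)
          have := (Subgroup.mem_normalizer_iff.1 hg q⁻¹).1 (inv_mem hq)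
          simpa [mul_assoc] using this
      rw [key]
      constructor
      · intro hg
        exact ⟨⟨g, by simpa using inv_mem hg⟩, congrArg QuotientGroup.mk (mul_one g)⟩
      · rintro ⟨⟨n, hn⟩, e⟩
        have : (n * 1)⁻¹ * g ∈ M := QuotientGroup.eq.1 e
        have : n⁻¹ * g ∈ N := h.le_normalizer (by simpa using this)
        have : g ∈ N := by simpa using mul_mem hn this
        exact inv_mem this
  have h2 : MulAction.stabilizer N ((1 : G) : G ⧸ M) = M.subgroupOf N := by
    ext n
    rw [MulAction.mem_stabilizer_iff, Subgroup.mem_subgroupOf]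
    change ((n * 1 : G) : G ⧸ M) = ((1 : G) : G ⧸ M) ↔ _
    rw [QuotientGroup.eq]
    simp
  rw [h1, Nat.card_coe_set_eq, ← MulAction.index_stabilizer, h2]
  rfl

/-- `M` is the preimage in N(Q) of a Sylow `p`-subgroup of N(Q)/Q; taking preimages under the
quotient map preserves the index. -/
theorem exists_isPNormal_not_dvd_relIndex (p : ℕ) [Fact p.Prime] (Q : Subgroup G) :
    ∃ M : Subgroup G, IsPNormal p Q M ∧ ¬ p ∣ M.relIndex (Subgroup.normalizer (Q : Set G)) := by
  let N := Subgroup.normalizer (Q : Set G)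
  have hn : (Q.subgroupOf N).Normal := inferInstance
  obtain ⟨P⟩ : Nonempty (Sylow p (N ⧸ Q.subgroupOf N)) := inferInstance
  let M' : Subgroup N := P.1.comap (QuotientGroup.mk' (Q.subgroupOf N))
  have hM : (M'.map N.subtype).subgroupOf N = M' :=
    Subgroup.comap_map_eq_self_of_injective N.subtype_injective M'
  refine ⟨M'.map N.subtype, ⟨?_, Subgroup.map_subtype_le _, ?_⟩, ?_⟩
  · intro q hq
    refine Subgroup.mem_map.2 ⟨⟨q, Subgroup.le_normalizer hq⟩, ?_, rfl⟩
    have : QuotientGroup.mk' (Q.subgroupOf N) ⟨q, Subgroup.le_normalizer hq⟩ = 1 :=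
      (QuotientGroup.eq_one_iff _).2 hq
    change QuotientGroup.mk' (Q.subgroupOf N) ⟨q, Subgroup.le_normalizer hq⟩ ∈ P.1
    rw [this]
    exact one_mem _
  · rintro _ ⟨x, hx, rfl⟩
    obtain ⟨n, hn'⟩ := P.2 ⟨_, hx⟩
    have : ((x ^ p ^ n : N) : N ⧸ Q.subgroupOf N) = 1 := congrArg Subtype.val hn'
    exact ⟨n, (QuotientGroup.eq_one_iff (N := Q.subgroupOf N) (x ^ p ^ n)).1 this⟩
  · change ¬ p ∣ ((M'.map N.subtype).subgroupOf N).index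
    rw [hM, Subgroup.index_comap_of_surjective _ (QuotientGroup.mk'_surjective _)]
    exact P.not_dvd_index

/-- Every element `H` of the `p`-hyper family has a number of fixed points prime to `p` on some
coset space of an element of this family. -/
theorem exists_mem_hyper_not_dvd_card_fixedPts (p : ℕ) [Fact p.Prime] (F : SubgroupFamily G)
    {H : Subgroup G} (hH : H ∈ (F.hyper p).carrier) :
    ∃ M ∈ (F.hyper p).carrier, ¬ p ∣ Nat.card (fixedPts H (G ⧸ M)) := by
  obtain ⟨M, hM, hp⟩ := exists_isPNormal_not_dvd_relIndex p (residual p H)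
  -- `M` is again in the hyper family because O^p(M) ≤ O^p(H), and the latter belongs to `F`.
  refine ⟨M, F.mem_of_le hM.residual_le hH, fun hd => hp ?_⟩
  rw [← card_fixedPts_quotient hM (residual_residual p H)]
  exact ((card_fixedPts_modEq (isPNormal_residual p H) (G ⧸ M)).dvd_iff dvd_rfl).2 hd

/-- Together with `stabilizer_toGSet_mem` this says that the isotropy family of `F.toGSet` is `F`. A
maximal member above `H` is conjugate to the chosen representative, and the conjugating element
names the required coset. -/
theorem exists_le_stabilizer_toGSet (F : SubgroupFamily G) {H : Subgroup G} (hH : H ∈ F.carrier) :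
    ∃ y : F.toGSet, H ≤ MulAction.stabilizer G y := by
  obtain ⟨K, hHK, hK⟩ := (Set.toFinite F.carrier).exists_le_maximal hH
  let c : Quotient F.maximalConj := Quotient.mk _ ⟨K, hK⟩
  obtain ⟨g, hg⟩ : F.maximalConj.r c.out ⟨K, hK⟩ := Quotient.exact c.out_eq
  refine ⟨⟨c, (g : G ⧸ c.out.1)⟩, fun x hx => ?_⟩
  have hx' : x ∈ c.out.1.map (MulAut.conj g).toMonoidHom := hg ▸ hHK hx
  obtain ⟨y, hy, rfl⟩ := hx'
  refine MulAction.mem_stabilizer_iff.2 (Sigma.ext rfl (heq_of_eq ?_))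
  change ((g * y * g⁻¹ * g : G) : G ⧸ c.out.1) = (g : G ⧸ c.out.1)
  refine QuotientGroup.eq.2 ?_
  simpa using hy

theorem stabilizer_toGSet_mem (F : SubgroupFamily G) (y : F.toGSet) :
    MulAction.stabilizer G y ∈ F.carrier := by
  obtain ⟨c, z⟩ := y
  induction z using QuotientGroup.induction_on with
  | H g =>
    refine F.mem_of_le ?_ (F.conj_mem c.out.2.1 g)
    intro x hx
    have h : ((x * g : G) : G ⧸ c.out.1) = (g : G ⧸ c.out.1) :=
      eq_of_heq (Sigma.ext_iff.1 (MulAction.mem_stabilizer_iff.1 hx)).2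
    exact ⟨g⁻¹ * x * g, by simpa [mul_assoc] using inv_mem (QuotientGroup.eq.1 h), by simp [mul_assoc]⟩

end Marks

open FinGSet
open Algebra (GrothendieckAddGroup)

/-! ### Classes of `G`-sets over a base -/

section Classes

variable {G : Type u} [Group G] {S : FinGSet G}

theorem burnsideClass_eq {X Y : GSetOver S} (e : X.total → Y.total)
    (he : Function.Bijective e) (hsmul : ∀ (g : G) x, e (g • x) = g • e x)
    (hh : ∀ x, Y.hom (e x) = X.hom x) : burnsideClass X = burnsideClass Y :=
  congrArg GrothendieckAddGroup.of (IsoClass.mk_eq e he hsmul hh)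

theorem burnsideClass_sum (X Y : GSetOver S) :
    burnsideClass (X.sum Y) = burnsideClass X + burnsideClass Y :=
  map_add GrothendieckAddGroup.of (IsoClass.mk X) (IsoClass.mk Y)

theorem burnsideClass_of_isEmpty (X : GSetOver S) [IsEmpty X.total] : burnsideClass X = 0 := by
  have h : IsoClass.mk X = IsoClass.mk (GSetOver.zero S) :=
    IsoClass.mk_eq (fun x => isEmptyElim x) ⟨fun x => isEmptyElim x, fun x => isEmptyElim x⟩
      (fun _ x => isEmptyElim x) (fun x => isEmptyElim x)
  exact (congrArg GrothendieckAddGroup.of h).trans (map_zero GrothendieckAddGroup.of)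

/-- The part of a finite `G`-set that is cut out by an invariant predicate. -/
def FinGSet.sub (X : FinGSet G) (P : X → Prop) (hP : ∀ (g : G) x, P x → P (g • x)) :
    FinGSet G where
  carrier := {x // P x}
  action :=
    { smul := fun g x => ⟨g • x.1, hP g x.1 x.2⟩
      one_smul := fun x => Subtype.ext (one_smul G x.1)
      mul_smul := fun a b x => Subtype.ext (mul_smul a b x.1) }

/-- The disjoint union of `n` copies of a finite `G`-set. -/
def FinGSet.copies (n : ℕ) (X : FinGSet G) : FinGSet G where
  carrier := Fin n × X
  action :=
    { smul := fun g x => (x.1, g • x.2)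
      one_smul := fun x => Prod.ext rfl (one_smul G x.2)
      mul_smul := fun a b x => Prod.ext rfl (mul_smul a b x.2) }

/-- The part of a `G`-set over `S` that is cut out by an invariant predicate. -/
def GSetOver.sub (X : GSetOver S) (P : X.total → Prop) (hP : ∀ (g : G) x, P x → P (g • x)) :
    GSetOver S where
  total := X.total.sub P hP
  hom :=
    { toFun := fun x => X.hom x.1
      map_smul' := fun g x => map_smul X.hom g x.1 }

/-- The disjoint union of `n` copies of a `G`-set over `S`. -/
def GSetOver.copies (n : ℕ) (X : GSetOver S) : GSetOver S where
  total := X.total.copies n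
  hom :=
    { toFun := fun x => X.hom x.2
      map_smul' := fun g x => map_smul X.hom g x.2 }

theorem not_smul_of_smul {X : Type v} [MulAction G X] {P : X → Prop}
    (hP : ∀ (g : G) x, P x → P (g • x)) (g : G) (x : X) (h : ¬ P x) : ¬ P (g • x) := fun h' =>
  h (by simpa using hP g⁻¹ _ h')

theorem burnsideClass_eq_sub_add_sub (X : GSetOver S) (P : X.total → Prop)
    (hP : ∀ (g : G) x, P x → P (g • x)) :
    burnsideClass X = burnsideClass (X.sub P hP) +
      burnsideClass (X.sub (fun x => ¬ P x) (not_smul_of_smul hP)) := by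
  classical
  rw [← burnsideClass_sum]
  symm
  refine burnsideClass_eq (X := (X.sub P hP).sum (X.sub (fun x => ¬ P x) (not_smul_of_smul hP)))
    (Y := X) (Equiv.sumCompl P) (Equiv.bijective _) ?_ ?_
  · rintro g (x | x) <;> rfl
  · rintro (x | x) <;> rfl

theorem burnsideClass_copies (n : ℕ) (X : GSetOver S) :
    burnsideClass (X.copies n) = n • burnsideClass X := by
  induction n with
  | zero =>
    have : IsEmpty (X.copies 0).total := inferInstanceAs (IsEmpty (Fin 0 × X.total))
    rw [burnsideClass_of_isEmpty, zero_smul]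
  | succ n ih =>
    rw [succ_nsmul, ← ih, ← burnsideClass_sum]
    symm
    refine burnsideClass_eq (X := (X.copies n).sum X) (Y := X.copies (n + 1))
      (Sum.elim (fun x => (Fin.castSucc x.1, x.2)) (fun x => (Fin.last n, x))) ⟨?_, ?_⟩ ?_ ?_
    · rintro (⟨i, x⟩ | x) (⟨j, y⟩ | y) h <;> obtain ⟨h1, h2⟩ := Prod.ext_iff.1 h
      · obtain rfl : i = j := Fin.castSucc_injective n h1
        obtain rfl : x = y := h2
        rfl
      · exact absurd h1 (Fin.castSucc_lt_last i).ne
      · exact absurd h1 (Fin.castSucc_lt_last j).ne'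
      · obtain rfl : x = y := h2
        rfl
    · rintro ⟨i, x⟩
      induction i using Fin.lastCases with
      | last => exact ⟨Sum.inr x, rfl⟩
      | cast i => exact ⟨Sum.inl (i, x), rfl⟩
    · rintro g (x | x) <;> rfl
    · rintro (x | x) <;> rfl

end Classes

/-! ### The Burnside ring at a point and its marks -/

section Point

variable {G : Type u} [Group G]

variable (G) in
/-- The value of the Burnside ring at the one-point `G`-set. -/
abbrev BurnsidePoint : Type (u + 1) := (burnsideMackey G).obj (point G)

theorem burnsideAct_class_class {S : FinGSet G} (X Y : GSetOver S) :
    burnsideAct (burnsideMackey G) S (burnsideClass X) (burnsideClass Y) =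
      burnsideClass (GSetOver.push X.hom (GSetOver.pull X.hom Y)) := by
  rw [burnsideAct_class, burnsideMackey_res_class, burnsideMackey_ind_class]

theorem burnsideAct_comm (S : FinGSet G) (a b : (burnsideMackey G).obj S) :
    burnsideAct (burnsideMackey G) S a b = burnsideAct (burnsideMackey G) S b a := by
  refine DFunLike.congr_fun (f := (burnsideAct (burnsideMackey G) S).flip b)
    (g := burnsideAct (burnsideMackey G) S b) (burnside_hom_ext fun X => ?_) a
  refine DFunLike.congr_fun (f := burnsideAct (burnsideMackey G) S (burnsideClass X))
    (g := (burnsideAct (burnsideMackey G) S).flip (burnsideClass X))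
    (burnside_hom_ext fun Y => ?_) b
  rw [AddMonoidHom.flip_apply, burnsideAct_class_class, burnsideAct_class_class]
  refine burnsideClass_eq (X := GSetOver.push X.hom (GSetOver.pull X.hom Y))
    (Y := GSetOver.push Y.hom (GSetOver.pull Y.hom X))
    (fun q => ⟨(q.1.2, q.1.1), q.2.symm⟩) ⟨?_, ?_⟩ (fun _ _ => rfl) (fun q => q.2.symm)
  · rintro ⟨⟨x, y⟩, h⟩ ⟨⟨x', y'⟩, h'⟩ hq
    obtain ⟨hy, hx⟩ := Prod.ext_iff.1 (Subtype.ext_iff.1 hq)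
    exact Subtype.ext (Prod.ext hx hy)
  · rintro ⟨⟨y, x⟩, h⟩
    exact ⟨⟨(x, y), h.symm⟩, rfl⟩

/-- A commutative ring structure on A(•) makes finite products of elements, ideals and prime
avoidance available. -/
noncomputable instance : CommRing (BurnsidePoint G) :=
  { (burnsideMackey G).grp (point G) with
    mul := fun a b => burnsideAct (burnsideMackey G) (point G) a b
    one := burnsideClass (GSetOver.id (point G))
    mul_assoc := (burnside G).mul_assoc (point G)
    one_mul := (burnside G).one_mul (point G)
    mul_one := (burnside G).mul_one (point G)
    mul_comm := burnsideAct_comm (point G)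
    left_distrib := fun a b c => map_add (burnsideAct (burnsideMackey G) (point G) a) b c
    right_distrib := fun a b c =>
      DFunLike.congr_fun (map_add (burnsideAct (burnsideMackey G) (point G)) a b) c
    zero_mul := fun a =>
      DFunLike.congr_fun (map_zero (burnsideAct (burnsideMackey G) (point G))) a
    mul_zero := fun a => map_zero (burnsideAct (burnsideMackey G) (point G) a) }

theorem burnsidePoint_mul_def (a b : BurnsidePoint G) :
    a * b = burnsideAct (burnsideMackey G) (point G) a b := rfl

theorem burnsidePoint_one_def :
    (1 : BurnsidePoint G) = burnsideClass (GSetOver.id (point G)) := rfl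

/-- The number of `H`-fixed points, on isomorphism classes. -/
noncomputable def isoClassMark (H : Subgroup G) : IsoClass (point G) →+ ℤ where
  toFun := Quotient.lift (fun X : GSetOver (point G) => (Nat.card (fixedPts H X.total) : ℤ)) (by
    rintro X Y ⟨e, he, -⟩
    have h : Nat.card (fixedPts H X.total) = Nat.card (fixedPts H Y.total) := by
      refine Nat.card_congr ((Equiv.ofBijective e he).subtypeEquiv fun x => ?_)
      refine forall₂_congr fun h _ => ?_
      rw [← he.1.eq_iff, map_smul]
      rfl
    exact congrArg Nat.cast h)
  map_zero' := by
    change (Nat.card (fixedPts H (FinGSet.empty G)) : ℤ) = 0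
    rw [Nat.card_of_isEmpty, Nat.cast_zero]
  map_add' := by
    rintro ⟨X⟩ ⟨Y⟩
    change (Nat.card (fixedPts H (FinGSet.sum X.total Y.total)) : ℤ) =
      Nat.card (fixedPts H X.total) + Nat.card (fixedPts H Y.total)
    rw [← Nat.cast_add, ← Nat.card_sum]
    refine congrArg Nat.cast (Nat.card_congr (Equiv.trans (Equiv.subtypeSum) ?_))
    refine Equiv.sumCongr (Equiv.subtypeEquivRight fun x => ?_)
      (Equiv.subtypeEquivRight fun x => ?_)
    · exact forall₂_congr fun h _ => Sum.inl_injective.eq_iff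
    · exact forall₂_congr fun h _ => Sum.inr_injective.eq_iff

/-- The mark homomorphism, which counts the points fixed by `H`, as a map of groups. -/
noncomputable def markAddHom (H : Subgroup G) : BurnsidePoint G →+ ℤ :=
  GrothendieckAddGroup.lift (isoClassMark H)

theorem markAddHom_class (H : Subgroup G) (X : GSetOver (point G)) :
    markAddHom H (burnsideClass X) = Nat.card (fixedPts H X.total) :=
  burnsideLift_mk (isoClassMark H) X

/-- The mark homomorphism, which counts the points fixed by `H`. -/
noncomputable def mark (H : Subgroup G) : BurnsidePoint G →+* ℤ :=
  { markAddHom H with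
    map_one' := by
      change markAddHom H (burnsideClass (GSetOver.id (point G))) = 1
      rw [markAddHom_class]
      have h : fixedPts H (point G) = Set.univ := Set.eq_univ_of_forall fun _ _ _ => rfl
      have h' : Nat.card (point G) = 1 := Nat.card_unique (α := PUnit.{u + 1})
      change (Nat.card (fixedPts H (point G)) : ℤ) = 1
      rw [h, Nat.card_univ, h', Nat.cast_one]
    map_mul' := fun a b => by
      change markAddHom H (burnsideAct (burnsideMackey G) (point G) a b) =
        markAddHom H a * markAddHom H b
      refine DFunLike.congr_fun
        (f := (markAddHom H).comp ((burnsideAct (burnsideMackey G) (point G)).flip b))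
        (g := (AddMonoidHom.mulRight (markAddHom H b)).comp (markAddHom H))
        (burnside_hom_ext fun X => ?_) a
      refine DFunLike.congr_fun
        (f := (markAddHom H).comp (burnsideAct (burnsideMackey G) (point G) (burnsideClass X)))
        (g := (AddMonoidHom.mulLeft (markAddHom H (burnsideClass X))).comp (markAddHom H))
        (burnside_hom_ext fun Y => ?_) b
      simp only [AddMonoidHom.comp_apply, AddMonoidHom.coe_mulLeft]
      rw [burnsideAct_class_class, markAddHom_class, markAddHom_class, markAddHom_class,
        ← Nat.cast_mul, ← Nat.card_prod]
      refine congrArg Nat.cast (Nat.card_congr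
        { toFun := fun q => (⟨q.1.1.1, fun h hh => congrArg (fun q => q.1.1) (q.2 h hh)⟩,
            ⟨q.1.1.2, fun h hh => congrArg (fun q => q.1.2) (q.2 h hh)⟩)
          invFun := fun q => ⟨⟨(q.1.1, q.2.1), rfl⟩, fun h hh =>
            Subtype.ext (Prod.ext (q.1.2 h hh) (q.2.2 h hh))⟩
          left_inv := fun _ => rfl
          right_inv := fun _ => rfl }) }

theorem mark_class (H : Subgroup G) (X : GSetOver (point G)) :
    mark H (burnsideClass X) = Nat.card (fixedPts H X.total) :=
  markAddHom_class H X

/-- The action of the Burnside ring at a point on the values of a Mackey functor. -/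
noncomputable def burnsideScalar (M : MackeyFunctor.{u, w} G) (S : FinGSet G) :
    BurnsidePoint G →+* AddMonoid.End (M.obj S) where
  toFun b := burnsideAct M S ((burnsideMackey G).res S.toPoint b)
  map_zero' := by rw [map_zero, map_zero]; rfl
  map_one' := by
    ext x
    rw [burnsidePoint_one_def]
    exact (congrArg (fun a => burnsideAct M S a x) ((burnside G).res_one S.toPoint)).trans
      (burnsideAct_id M S x)
  map_add' a b := by rw [map_add, map_add]; rfl
  map_mul' a b := by
    ext x
    rw [burnsidePoint_mul_def]
    exact (congrArg (fun a => burnsideAct M S a x)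
      ((burnsidePairing (burnsideMackey G)).res_pair S.toPoint a b)).trans (burnsideAct_act M S _ _ x)

/-- The pullback over a point is the product W × Z, with the diagonal action and mapped to `S`
through `W`. The triangularity argument counts its orbits. -/
theorem burnsideScalar_class (S : FinGSet G) (Z : GSetOver (point G)) (W : GSetOver S) :
    burnsideScalar (burnsideMackey G) S (burnsideClass Z) (burnsideClass W) =
      burnsideClass (GSetOver.push W.hom (GSetOver.pull W.total.toPoint Z)) := by
  have h1 : burnsideClass W = (burnsideMackey G).ind W.hom (burnsideClass (GSetOver.id W.total)) :=
    (burnsideMackey_ind_class W.hom (GSetOver.id W.total)).symm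
  have h2 : (burnsideMackey G).res W.hom ((burnsideMackey G).res S.toPoint (burnsideClass Z)) =
      burnsideClass (GSetOver.pull W.total.toPoint Z) := by
    rw [← (burnsideMackey G).res_comp, ← burnsideMackey_res_class]
    rfl
  rw [h1]
  refine ((burnsidePairing (burnsideMackey G)).pair_ind W.hom _ _).trans ?_
  rw [h2, ← burnsideMackey_ind_class]
  exact congrArg _ ((burnside G).mul_one W.total _)

variable (G) in
/-- The image of the Burnside ring at `S` is an ideal of the Burnside ring at a point. -/
noncomputable def inductionIdeal (S : FinGSet G) : Ideal (BurnsidePoint G) where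
  carrier := Set.range ((burnsideMackey G).ind S.toPoint)
  add_mem' := by
    rintro _ _ ⟨a, rfl⟩ ⟨b, rfl⟩
    exact ⟨a + b, map_add _ _ _⟩
  zero_mem' := ⟨0, map_zero _⟩
  smul_mem' := by
    rintro b _ ⟨a, rfl⟩
    exact ⟨_, ((burnsidePairing (burnsideMackey G)).pair_ind S.toPoint b a).symm⟩

end Point

/-! ### Triangularity of the action of the Burnside ring -/

section Triangular

variable {G : Type u} [Group G]

/-- The subgroup generated by the classes of the `G`-sets over `S` all of whose isotropy groups
have order less than `n`. -/
noncomputable def smallIsotropy (S : FinGSet G) (n : ℕ) : AddSubgroup ((burnsideMackey G).obj S) :=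
  AddSubgroup.closure {c | ∃ W : GSetOver S,
    (∀ x : W.total, Nat.card (MulAction.stabilizer G x) < n) ∧ c = burnsideClass W}

theorem smallIsotropy_mono (S : FinGSet G) {m n : ℕ} (h : m ≤ n) :
    smallIsotropy S m ≤ smallIsotropy S n :=
  AddSubgroup.closure_mono fun _ ⟨W, hW, hc⟩ => ⟨W, fun x => (hW x).trans_le h, hc⟩

theorem stabilizer_smul_le_stabilizer_smul {X : Type v} {Y : Type w} [MulAction G X] [MulAction G Y]
    {x : X} {y : Y} (h : MulAction.stabilizer G x ≤ MulAction.stabilizer G y) (g : G) :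
    MulAction.stabilizer G (g • x) ≤ MulAction.stabilizer G (g • y) := by
  rw [MulAction.stabilizer_smul_eq_stabilizer_map_conj,
    MulAction.stabilizer_smul_eq_stabilizer_map_conj]
  exact Subgroup.map_mono h

theorem card_stabilizer_smul {X : Type v} [MulAction G X] (g : G) (x : X) :
    Nat.card (MulAction.stabilizer G (g • x)) = Nat.card (MulAction.stabilizer G x) := by
  rw [MulAction.stabilizer_smul_eq_stabilizer_map_conj]
  exact Subgroup.card_map_of_injective (MulAut.conj g).injective

variable [Finite G]

/-- The class of a `G`-set acts on a transitive `G`-set over `S` by its mark at the isotropy group,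
up to `G`-sets with smaller isotropy groups. -/
theorem burnsideScalar_class_sub_mem {S : FinGSet G} (W : GSetOver S) (w : W.total)
    (hw : ∀ x : W.total, ∃ g : G, g • w = x) (Z : GSetOver (point G)) :
    burnsideScalar (burnsideMackey G) S (burnsideClass Z) (burnsideClass W) -
        mark (MulAction.stabilizer G w) (burnsideClass Z) • burnsideClass W ∈
      smallIsotropy S (Nat.card (MulAction.stabilizer G w)) := by
  let H := MulAction.stabilizer G w
  let E : GSetOver S := GSetOver.push W.hom (GSetOver.pull W.total.toPoint Z)
  -- `P` selects the pairs (x, z) in W × Z whose stabilizer is as large as that of x; they form one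
  -- copy of `W` for each `H`-fixed point of `Z`.
  let P : E.total → Prop := fun q => MulAction.stabilizer G q.1.1 ≤ MulAction.stabilizer G q.1.2
  have hP : ∀ (g : G) q, P q → P (g • q) := fun g q hq => stabilizer_smul_le_stabilizer_smul hq g
  have hE : burnsideClass (E.sub P hP) =
      Nat.card (fixedPts H Z.total) • burnsideClass W := by
    let ε := Finite.equivFin (fixedPts H Z.total)
    choose γ hγ using hw
    rw [← burnsideClass_copies]
    symm
    -- The choice `γ x` carrying `w` to x is unique only modulo `H`, which does not matter on points
    -- fixed by `H`. Hence x ↦ (x, γ x • z) is equivariant.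
    have key : ∀ (g : G) (x : W.total) (z : fixedPts H Z.total),
        γ (g • x) • z.1 = g • γ x • z.1 := by
      intro g x z
      have h1 : (γ (g • x))⁻¹ * (g * γ x) ∈ H := by
        rw [MulAction.mem_stabilizer_iff, mul_smul, mul_smul, hγ, inv_smul_eq_iff, hγ]
      have h2 := z.2 _ h1
      rw [mul_smul, mul_smul, inv_smul_eq_iff] at h2
      exact h2.symm
    have mem : ∀ (x : W.total) (z : fixedPts H Z.total),
        MulAction.stabilizer G x ≤ MulAction.stabilizer G (γ x • z.1) := by
      intro x z
      have h1 : H ≤ MulAction.stabilizer G z.1 := fun h hh => z.2 h hh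
      have h2 := stabilizer_smul_le_stabilizer_smul h1 (γ x)
      rwa [hγ] at h2
    refine burnsideClass_eq (X := W.copies (Nat.card (fixedPts H Z.total))) (Y := E.sub P hP)
      (fun q => ⟨⟨(q.2, γ q.2 • (ε.symm q.1).1), rfl⟩, mem q.2 (ε.symm q.1)⟩) ⟨?_, ?_⟩ ?_
      (fun _ => rfl)
    · rintro ⟨i, x⟩ ⟨j, y⟩ h
      obtain ⟨h1, h2⟩ := Prod.ext_iff.1 (Subtype.ext_iff.1 (Subtype.ext_iff.1 h))
      obtain rfl : x = y := h1
      have h3 : (ε.symm i).1 = (ε.symm j).1 := smul_left_cancel _ h2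
      obtain rfl : i = j := ε.symm.injective (Subtype.ext h3)
      rfl
    · rintro ⟨⟨⟨x, z⟩, h⟩, hq⟩
      have h1 : (γ x)⁻¹ • z ∈ fixedPts H Z.total := by
        have h2 := stabilizer_smul_le_stabilizer_smul
          (show MulAction.stabilizer G x ≤ MulAction.stabilizer G z from hq) (γ x)⁻¹
        have h3 : (γ x)⁻¹ • x = w := by rw [inv_smul_eq_iff, hγ]
        rw [h3] at h2
        exact fun h hh => h2 hh
      refine ⟨(ε ⟨_, h1⟩, x), Subtype.ext (Subtype.ext (Prod.ext rfl ?_))⟩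
      change γ x • (ε.symm (ε ⟨_, h1⟩)).1 = z
      rw [Equiv.symm_apply_apply, smul_inv_smul]
    · rintro g ⟨i, x⟩
      exact Subtype.ext (Subtype.ext (Prod.ext rfl (key g x (ε.symm i))))
  rw [burnsideScalar_class, mark_class, burnsideClass_eq_sub_add_sub E P hP, hE, natCast_zsmul,
    add_sub_cancel_left]
  refine AddSubgroup.subset_closure ⟨_, ?_, rfl⟩
  intro q
  obtain ⟨g, hg⟩ := hw q.1.1.1
  rw [← card_stabilizer_smul g w, hg]
  have h1 : MulAction.stabilizer G q ≤ MulAction.stabilizer G q.1.1.1 := fun x hx =>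
    congrArg (fun q : (E.sub (fun x => ¬ P x) (not_smul_of_smul hP)).total => q.1.1.1) hx
  -- The stabilizer of (x, z) is that of x intersected with that of z. Equal orders would put the
  -- former inside the latter, against the failure of `P`.
  refine lt_of_le_of_ne (Subgroup.card_le_of_le h1) fun h2 => q.2 ?_
  change MulAction.stabilizer G q.1.1.1 ≤ MulAction.stabilizer G q.1.1.2
  rw [← Subgroup.eq_of_le_of_card_ge h1 h2.ge]
  exact fun x hx =>
    congrArg (fun q : (E.sub (fun x => ¬ P x) (not_smul_of_smul hP)).total => q.1.1.2) hx

/-- Both the action and the mark are additive in `b`, so the congruence for classes of `G`-sets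
extends to virtual ones on comparing two homomorphisms into the quotient by `smallIsotropy`. -/
theorem burnsideScalar_sub_mark_mem {S : FinGSet G} (W : GSetOver S) (w : W.total)
    (hw : ∀ x : W.total, ∃ g : G, g • w = x) (b : BurnsidePoint G) :
    burnsideScalar (burnsideMackey G) S ((mark (MulAction.stabilizer G w) b : BurnsidePoint G) - b)
        (burnsideClass W) ∈ smallIsotropy S (Nat.card (MulAction.stabilizer G w)) := by
  let L := smallIsotropy S (Nat.card (MulAction.stabilizer G w))
  let f : BurnsidePoint G →+ (burnsideMackey G).obj S := AddMonoidHom.mk'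
    (fun b => burnsideScalar (burnsideMackey G) S b (burnsideClass W)) fun a b => by
      rw [map_add]; rfl
  let h : BurnsidePoint G →+ (burnsideMackey G).obj S := AddMonoidHom.mk'
    (fun b => mark (MulAction.stabilizer G w) b • burnsideClass W) fun a b => by
      rw [map_add, add_smul]
  have hfh : (QuotientAddGroup.mk' L).comp f = (QuotientAddGroup.mk' L).comp h := by
    refine burnside_hom_ext fun Z => ?_
    refine (QuotientAddGroup.eq_iff_sub_mem (N := L)).2 ?_
    exact burnsideScalar_class_sub_mem W w hw Z
  have h1 : h b - f b ∈ L :=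
    (QuotientAddGroup.eq_iff_sub_mem (N := L)).1 (DFunLike.congr_fun hfh b).symm
  have h2 : burnsideScalar (burnsideMackey G) S
      ((mark (MulAction.stabilizer G w) b : BurnsidePoint G) - b) (burnsideClass W) = h b - f b := by
    rw [map_sub, map_intCast]
    rfl
  rw [h2]
  exact h1

/-- A power of the product of all `φ_H(r) - r`, for `H` in a family that contains the isotropy
groups of `S`, annihilates the values of the Burnside ring at `S`. -/
theorem burnsideScalar_prod_pow_eq_zero {S : FinGSet G} (T : Finset (Subgroup G))
    (hT : ∀ (H : Subgroup G) (s : S), H ≤ MulAction.stabilizer G s → H ∈ T) (r : BurnsidePoint G)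
    (n : ℕ) : ∀ x ∈ smallIsotropy S n,
      burnsideScalar (burnsideMackey G) S ((∏ H ∈ T, ((mark H r : BurnsidePoint G) - r)) ^ n) x
        = 0 := by
  classical
  induction n with
  | zero =>
    intro x hx
    induction hx using AddSubgroup.closure_induction with
    | mem x hx =>
      obtain ⟨W, hW, rfl⟩ := hx
      have : IsEmpty W.total := ⟨fun x => absurd (hW x) (Nat.not_lt_zero _)⟩
      rw [burnsideClass_of_isEmpty, map_zero]
    | zero => exact map_zero _
    | add x y _ _ hx hy => rw [map_add, hx, hy, add_zero]
    | neg x _ hx => rw [map_neg, hx, neg_zero]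
  | succ n ih =>
    intro x hx
    induction hx using AddSubgroup.closure_induction with
    | zero => exact map_zero _
    | add x y _ _ hx hy => rw [map_add, hx, hy, add_zero]
    | neg x _ hx => rw [map_neg, hx, neg_zero]
    | mem x hx =>
      obtain ⟨W, hW, rfl⟩ := hx
      -- `W` is taken apart one orbit at a time: the complement of an orbit is smaller and falls
      -- under the inner induction.
      induction hN : Nat.card W.total using Nat.strong_induction_on generalizing W with
      | _ N IH =>
      rcases isEmpty_or_nonempty W.total with hemp | ⟨⟨w⟩⟩
      · rw [burnsideClass_of_isEmpty, map_zero]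
      have hP : ∀ (g : G) x, x ∈ MulAction.orbit G w → g • x ∈ MulAction.orbit G w :=
        fun g x hx => MulAction.mem_orbit_of_mem_orbit g hx
      have hstab : ∀ (P : W.total → Prop) (hP : ∀ (g : G) x, P x → P (g • x))
          (x : (W.sub P hP).total),
          MulAction.stabilizer G x = MulAction.stabilizer G x.1 := fun P hP x =>
        Subgroup.ext fun g => Subtype.ext_iff
      rw [burnsideClass_eq_sub_add_sub W (· ∈ MulAction.orbit G w) hP, map_add]
      have h1 : burnsideScalar (burnsideMackey G) S
          ((∏ H ∈ T, ((mark H r : BurnsidePoint G) - r)) ^ (n + 1))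
          (burnsideClass (W.sub (fun x => ¬ x ∈ MulAction.orbit G w) (not_smul_of_smul hP))) = 0 := by
        refine IH _ ?_ _ (fun x => ?_) rfl
        · rw [← hN]
          exact Finite.card_subtype_lt (x := w) fun h => h (MulAction.mem_orbit_self w)
        · rw [hstab]
          exact hW x.1
      rw [h1, add_zero]
      let W' := W.sub (· ∈ MulAction.orbit G w) hP
      let w' : W'.total := ⟨w, MulAction.mem_orbit_self w⟩
      have hw' : ∀ x : W'.total, ∃ g : G, g • w' = x := by
        rintro ⟨_, g, rfl⟩
        exact ⟨g, rfl⟩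
      have hH : MulAction.stabilizer G w' ∈ T := by
        refine hT _ (W'.hom w') fun g hg => ?_
        rw [MulAction.mem_stabilizer_iff, ← map_smul, MulAction.mem_stabilizer_iff.1 hg]
      have hn : Nat.card (MulAction.stabilizer G w') ≤ n := by
        rw [hstab]
        exact Nat.lt_succ_iff.1 (hW w)
      have h2 := ih _ (smallIsotropy_mono S hn (burnsideScalar_sub_mark_mem W' w' hw' r))
      -- One factor of the extra copy of the product, the one for the stabilizer of `w'`, lowers the
      -- isotropy bound; the remaining `n`-th power then kills the result, and the other factors are
      -- harmless.
      have h3 : (∏ H ∈ T, ((mark H r : BurnsidePoint G) - r)) ^ (n + 1) =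
          (∏ H ∈ T.erase (MulAction.stabilizer G w'), ((mark H r : BurnsidePoint G) - r)) *
            ((∏ H ∈ T, ((mark H r : BurnsidePoint G) - r)) ^ n *
              ((mark (MulAction.stabilizer G w') r : BurnsidePoint G) - r)) := by
        rw [pow_succ, mul_left_comm, Finset.prod_erase_mul _ _ hH]
      rw [h3, map_mul, map_mul]
      change burnsideScalar (burnsideMackey G) S _ (burnsideScalar (burnsideMackey G) S _
        (burnsideScalar (burnsideMackey G) S _ (burnsideClass W'))) = 0
      rw [h2, map_zero]

/-- The scalar action on the unit of A(S) is restriction itself. The exponent |G| + 1 is a strict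
bound for the orders of all stabilizers. -/
theorem res_toPoint_eq_zero {S : FinGSet G} (T : Finset (Subgroup G))
    (hT : ∀ (H : Subgroup G) (s : S), H ≤ MulAction.stabilizer G s → H ∈ T) (r : BurnsidePoint G) :
    (burnsideMackey G).res S.toPoint
      ((∏ H ∈ T, ((mark H r : BurnsidePoint G) - r)) ^ (Nat.card G + 1)) = 0 := by
  have h := burnsideScalar_prod_pow_eq_zero T hT r (Nat.card G + 1) (burnsideClass (GSetOver.id S))
    (AddSubgroup.subset_closure ⟨_, fun x => Nat.lt_succ_of_le (Subgroup.card_le_card_group _), rfl⟩)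
  exact ((burnside G).mul_one S _).symm.trans h

/-- The congruence form of Dress's theorem: if each isotropy group `H` of `S` has a number of fixed
points prime to `p` on some `G ⧸ M` with `M` an isotropy group of `S`, then the image of induction
from `S` and the kernel of restriction to `S` are comaximal at `p`. -/
theorem exists_res_intCast_sub_ind_eq_zero (p : ℕ) (hp : p.Prime) (S : FinGSet G)
    (hS : ∀ (H : Subgroup G) (s : S), H ≤ MulAction.stabilizer G s →
      ∃ (M : Subgroup G) (t : S), M ≤ MulAction.stabilizer G t ∧
        ¬ p ∣ Nat.card (fixedPts H (G ⧸ M))) :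
    ∃ k : ℤ, ¬ (p : ℤ) ∣ k ∧ ∃ a : (burnsideMackey G).obj S,
      (burnsideMackey G).res S.toPoint
        ((k : BurnsidePoint G) - (burnsideMackey G).ind S.toPoint a) = 0 := by
  classical
  have := Fintype.ofFinite (Subgroup G)
  have hpp : (Ideal.span {(p : ℤ)}).IsPrime :=
    have : Fact p.Prime := ⟨hp⟩
    inferInstance
  have hpi : Prime (p : ℤ) := Nat.prime_iff_prime_int.1 hp
  let T : Finset (Subgroup G) := {H | ∃ s : S, H ≤ MulAction.stabilizer G s}
  let I := inductionIdeal G S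
  obtain ⟨r, hrI, hr⟩ : ∃ r ∈ I, ∀ H ∈ T, ¬ (p : ℤ) ∣ mark H r := by
    by_contra! hcon
    have h1 : (I : Set (BurnsidePoint G)) ⊆
        ⋃ H ∈ (T : Set (Subgroup G)), ((Ideal.span {(p : ℤ)}).comap (mark H) : Set _) := by
      intro r hr
      obtain ⟨H, hH, hd⟩ := hcon r hr
      exact Set.mem_biUnion hH (Ideal.mem_span_singleton.2 hd)
    -- Prime avoidance tolerates two non-prime members; all the ideals here are prime, so the
    -- indices `⊥` are placeholders.
    obtain ⟨H, hH, hle⟩ := (Ideal.subset_union_prime ⊥ ⊥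
      fun H _ _ _ => Ideal.comap_isPrime (mark H) _).1 h1
    obtain ⟨s, hs⟩ := (Finset.mem_filter.1 hH).2
    obtain ⟨M, t, hMt, hM⟩ := hS H s hs
    -- G/M maps to `S` through the orbit of `t`, so its class is induced from `S`, while its mark at
    -- `H` is prime to `p`.
    let W : GSetOver S :=
      { total := { carrier := G ⧸ M }
        hom :=
          { toFun := fun x => Quotient.liftOn' x (fun g => g • t) fun g g' h => by
              have := MulAction.mem_stabilizer_iff.1 (hMt (QuotientGroup.leftRel_apply.1 h))
              rw [mul_smul, inv_smul_eq_iff] at this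
              exact this.symm
            map_smul' := fun g x => by
              induction x using QuotientGroup.induction_on with
              | H x => exact mul_smul g x t } }
    have h2 := hle ⟨burnsideClass W, rfl⟩
    rw [burnsideMackey_ind_class, Ideal.mem_comap, Ideal.mem_span_singleton, mark_class] at h2
    exact hM (Int.natCast_dvd_natCast.1 h2)
  let π := ∏ H ∈ T, ((mark H r : BurnsidePoint G) - r)
  let k := (∏ H ∈ T, mark H r) ^ (Nat.card G + 1)
  -- Modulo `I` the element `r` vanishes, so each factor of `π` becomes the integer `mark H r`.
  have hk : (k : BurnsidePoint G) - π ^ (Nat.card G + 1) ∈ I := by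
    rw [← Ideal.Quotient.eq]
    simp only [k, π, Int.cast_pow, Int.cast_prod, map_pow, map_prod, map_sub,
      Ideal.Quotient.eq_zero_iff_mem.2 hrI, sub_zero]
  obtain ⟨a, ha⟩ := hk
  refine ⟨k, fun hd => ?_, a, ?_⟩
  · obtain ⟨H, hH, hd'⟩ := hpi.exists_mem_finset_dvd (hpi.dvd_of_dvd_pow hd)
    exact hr H hH hd'
  · rw [ha, sub_sub_cancel]
    exact res_toPoint_eq_zero T (fun H s hs => Finset.mem_filter.2 ⟨Finset.mem_univ _, s, hs⟩) r

end Triangular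

/-! ### Dress generating sets of a Green ring and of its Burnside quotient -/

section Main

variable {G : Type u} [Group G]

/-- A(S) acts by right-linear maps, hence an element acts as left multiplication by its value on the
unit. -/
theorem GreenRing.burnsideAct_mul (R : GreenRing.{u, w} G) (S : FinGSet G)
    (a : (burnsideMackey G).obj S) (x y : R.toMackey.obj S) :
    burnsideAct R.toMackey S a (R.mul.pair S x y) =
      R.mul.pair S (burnsideAct R.toMackey S a x) y := by
  refine DFunLike.congr_fun (f := (burnsideAct R.toMackey S).flip (R.mul.pair S x y))
    (g := ((R.mul.pair S).flip y).comp ((burnsideAct R.toMackey S).flip x))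
    (burnside_hom_ext fun X => ?_) a
  simp only [AddMonoidHom.comp_apply, AddMonoidHom.flip_apply, burnsideAct_class]
  rw [R.mul.res_pair, R.mul.ind_pair]

/-- An element of the Burnside ring at a point that annihilates the unit of a Green ring lies in the
annihilator of its underlying Mackey functor. -/
theorem GreenRing.mem_annihilator_of_act_one (R : GreenRing.{u, w} G) (c : BurnsidePoint G)
    (hc : burnsideAct R.toMackey (point G) c (R.one (point G)) = 0) :
    c ∈ (burnsideModule R.toMackey).annihilator.ideal (point G) := by
  have key : ∀ (S : FinGSet G) (b : (burnsideMackey G).obj S),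
      burnsideAct R.toMackey S b (R.one S) = 0 → ∀ z, burnsideAct R.toMackey S b z = 0 := by
    intro S b hb z
    have h := R.burnsideAct_mul S b (R.one S) z
    rwa [R.one_mul, hb, map_zero, AddMonoidHom.zero_apply] at h
  refine ⟨fun T φ y => ?_, fun U ψ z => key U _ ?_ z⟩
  · refine ((burnsideModule R.toMackey).ind_pair φ c y).trans ?_
    exact (congrArg _ (key _ c hc _)).trans (map_zero _)
  · rw [← R.res_one ψ]
    exact ((burnsidePairing R.toMackey).res_pair ψ c (R.one (point G))).symm.trans
      ((congrArg _ hc).trans (map_zero _))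

theorem GreenRing.quotient_mk_eq_iff (R : GreenRing.{u, w} G) (I : GreenIdeal R) (S : FinGSet G)
    (a b : R.toMackey.obj S) :
    QuotientAddGroup.mk' (I.ideal S) a = QuotientAddGroup.mk' (I.ideal S) b ↔ a - b ∈ I.ideal S :=
  QuotientAddGroup.eq_iff_sub_mem

variable [Finite G]

theorem isDressGeneratingSet_of_burnsideQuotient (R : GreenRing.{u, w} G) (X : FinGSet G)
    (h : IsDressGeneratingSet (burnsideQuotient R.toMackey) X) : IsDressGeneratingSet R X := by
  rw [isDressGeneratingSet_iff] at h ⊢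
  intro p hp y
  obtain ⟨k, hk, x, hx⟩ := h p hp ((burnsideQuotient R.toMackey).one (point G))
  induction x using QuotientAddGroup.induction_on with
  | H a =>
    let M := burnsideMackey G
    have h1 : (M.ind (hyperGSet p X).toPoint a - k • burnsideClass (GSetOver.id (point G)) :
        BurnsidePoint G) ∈ (burnsideModule R.toMackey).annihilator.ideal (point G) :=
      ((burnside G).quotient_mk_eq_iff _ _ _ _).1 hx
    -- Restriction along the identity turns membership in the annihilator ideal into vanishing of
    -- the action on `y`.
    have h2 := h1.2 (point G) (MulActionHom.id G) y
    erw [(burnside G).toMackey.res_id] at h2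
    refine ⟨k, hk, burnsideAct R.toMackey _ a (R.toMackey.res (hyperGSet p X).toPoint y), ?_⟩
    change burnsideAct R.toMackey (point G) _ y = 0 at h2
    rw [map_sub, map_zsmul, AddMonoidHom.sub_apply, AddMonoidHom.zsmul_apply, burnsideAct_id,
      sub_eq_zero] at h2
    rw [← h2]
    exact ((burnsidePairing R.toMackey).ind_pair _ a y).symm

theorem isDressGeneratingSet_burnsideQuotient (R : GreenRing.{u, w} G) (X : FinGSet G)
    (h : IsDressGeneratingSet R X) : IsDressGeneratingSet (burnsideQuotient R.toMackey) X := by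
  rw [isDressGeneratingSet_iff] at h ⊢
  intro p hp y
  have hfact : Fact p.Prime := ⟨hp⟩
  let S := hyperGSet p X
  let M := burnsideMackey G
  obtain ⟨k, hk, x, hx⟩ := h p hp (R.one (point G))
  -- The subgroups of isotropy groups of `S` are exactly the members of the hyper family, so the
  -- subgroup found there also lies in an isotropy group of `S`.
  obtain ⟨l, hl, a, ha⟩ := exists_res_intCast_sub_ind_eq_zero p hp S fun H s hs => by
    let F := SubgroupFamily.isotropy X
    have hH : H ∈ (F.hyper p).carrier :=
      (F.hyper p).mem_of_le hs (stabilizer_toGSet_mem (F.hyper p) s)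
    obtain ⟨K, hK, hpK⟩ := exists_mem_hyper_not_dvd_card_fixedPts p F hH
    obtain ⟨t, ht⟩ := exists_le_stabilizer_toGSet (F.hyper p) hK
    exact ⟨K, t, ht, hpK⟩
  let c : BurnsidePoint G := (l : BurnsidePoint G) - M.ind S.toPoint a
  have hc : burnsideAct R.toMackey (point G) (k • c) (R.one (point G)) = 0 := by
    rw [map_zsmul, AddMonoidHom.zsmul_apply, ← map_zsmul, ← hx]
    refine ((burnsidePairing R.toMackey).pair_ind S.toPoint c x).trans ?_
    change R.toMackey.ind S.toPoint (burnsideAct R.toMackey S (M.res S.toPoint c) x) = 0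
    rw [ha, map_zero, AddMonoidHom.zero_apply, map_zero]
  have hmem := R.mem_annihilator_of_act_one _ hc
  induction y using QuotientAddGroup.induction_on with
  | H b' =>
    let b : BurnsidePoint G := b'
    refine ⟨k * l, fun hd => ?_,
      QuotientAddGroup.mk' _ (k • burnsideAct M S a (M.res S.toPoint b)), ?_⟩
    · exact (Int.Prime.dvd_mul' hp hd).elim hk hl
    · symm
      have h1 := (burnsideModule R.toMackey).annihilator.mul_mem_right (point G) b hmem
      -- By Frobenius reciprocity the difference is a multiple of `k • c`, which the annihilator
      -- ideal contains.
      have h2 : (k * l) • b - M.ind S.toPoint (k • burnsideAct M S a (M.res S.toPoint b)) =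
          (k • c) * b := by
        have h3 : M.ind S.toPoint (burnsideAct M S a (M.res S.toPoint b)) =
            M.ind S.toPoint a * b := ((burnsidePairing M).ind_pair S.toPoint a b).symm
        rw [map_zsmul, h3, smul_mul_assoc, sub_mul, smul_sub, mul_smul, zsmul_eq_mul b l]
      refine ((burnside G).quotient_mk_eq_iff _ _ _ _).2 (?_ :
        (k * l) • b - M.ind S.toPoint (k • burnsideAct M S a (M.res S.toPoint b)) ∈ _)
      rw [h2]
      exact h1

end Main

end DressInduction

open DressInduction in
theorem theorem3p3 {G : Type u} [Group G] [Finite G] (𝒢 : GreenRing.{u, w} G) (X : FinGSet G) :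
    IsDressGeneratingSet 𝒢 X ↔ IsDressGeneratingSet (burnsideQuotient 𝒢.toMackey) X :=
  ⟨isDressGeneratingSet_burnsideQuotient 𝒢 X, isDressGeneratingSet_of_burnsideQuotient 𝒢 X⟩
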